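/- **Setting (combinatorial linear semi-bandit).** Let $d,N,k,T\ge 1$ be integers. In each round $t=1,\dots,T$ the learner observes feature vectors $x_t(i)\in\mathbb R^d$, $i\in[N]$, and a non-empty family $S_t\subseteq\{I\subseteq[N]:|I|\le k\}$ of available super arms (both may be random and depend on the past), plays some $I_t\in S_t$, and observes the rewards $r_t(i)$, $i\in I_t$. Let $\mathcal H_{t-1}$ be the $\sigma$-algebra generated by $\{x_s(i)\}_{i\in[N]}$ and $I_s$ for $s\le t$ and by $\{r_s(i)\}_{i\in I_s}$ for $s\le t-1$. There are constants $R,S\ge 0$ and a parameter $\theta^*\in\mathbb R^d$ with $\|\theta^*\|_2\le S$, $\|x_t(i)\|_2\le 1$, $\mathbb E[r_t(i)\mid\mathcal H_{t-1}]=\theta^{*\top}x_t(i)$, and the noise $\eta_t(i)=r_t(i)-\theta^{*\top}x_t(i)$ is conditionally $R$-sub-Gaussian, jointly over the arms of a round: $\mathbb E\bigl[e^{\sum_i c_i\eta_t(i)}\mid\mathcal H_{t-1}\bigr]\le e^{R^2\sum_i c_i^2/2}$ a.s. for all $c\in\mathbb R^N$ (as is the case when, given $\mathcal H_{t-1}$,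 the noises of round $t$ are independent and each is $R$-sub-Gaussian). The regret is $$R(T)=\sum_{t=1}^T\Bigl(\max_{I\in S_t}\sum_{i\in I}\theta^{*\top}x_t(i)-\sum_{i\in I_t}\theta^{*\top}x_t(i)\Bigr).$$ **Algorithm (Thompson sampling with round-wise randomization, parameters $\lambda$ and $v_t$).** Let $V_0=\lambda I$, $b_0=0$, and $V_t=V_{t-1}+\sum_{i\in I_t}x_t(i)x_t(i)^\top$, $b_t=b_{t-1}+\sum_{i\in I_t}r_t(i)x_t(i)$. In round $t$, let $\hat\theta_t=V_{t-1}^{-1}b_{t-1}$, draw one $\tilde\theta_t$, shared by all arms, from $\mathcal N(\hat\theta_t,v_t^2V_{t-1}^{-1})$, conditionally on the features and available super arms of the rounds $1,\dots,t$ and the plays and observed rewards of the rounds $1,\dots,t-1$, and play $I_t\in\operatorname{argmax}_{I\in S_t}\sum_{i\in I}\tilde\theta_t^\top x_t(i)$, with ties broken arbitrarily. **Theorem.** Let $\beta_t(\delta)=R\sqrt{d\log\frac{1+kt/\lambda}{\delta}}+\sqrt\lambda\,S$. There is $m\in\mathbb N$ and, for all $R,S\ge 0$, a constant $C>0$ depending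 only on $R$ and $S$, such that for all $d,N,k,T$ as above, $\lambda\ge 1$ and $\delta\in(0,1)$, the algorithm with $v_t=\beta_t(\delta/(4T))$ for $t\in[T]$ satisfies, with probability at least $1-\delta$, $$R(T)\le C\Bigl(1+\log\frac{dTNk}{\delta}\Bigr)^m\cdot\begin{cases}\max(d,\sqrt{d\lambda})\,\sqrt{dk^2T/\lambda}&\text{if }\lambda\le k,\\ \max(d,\sqrt{d\lambda})\,\sqrt{dkT}&\text{if }\lambda\ge k.\end{cases}$$ -/

import Mathlib

open MeasureTheory ProbabilityTheory

noncomputable section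

namespace CLS

/-- Feature and parameter space `ℝᵈ` with the Euclidean norm. -/
abbrev Vec (d : ℕ) : Type := EuclideanSpace ℝ (Fin d)

/-- The trajectories of an interaction with `N` arms in dimension `d`, over the sample space `Ω`.
Rounds are numbered `1, 2, …, T`; the value at the index `0` is never used. -/
structure Run (Ω : Type*) (d N : ℕ) where
  /-- the feature vector `x_t(i)` -/
  feature : ℕ → Fin N → Ω → Vec d
  /-- the family `S_t` of available super arms -/
  avail : ℕ → Ω → Finset (Finset (Fin N))
  /-- the parameter `θ̃_t` sampled by the learner, shared by all arms of the round -/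
  sample : ℕ → Ω → Vec d
  /-- the super arm `I_t` that is played -/
  play : ℕ → Ω → Finset (Fin N)
  /-- the reward `r_t(i)`; the learner observes it only if `i ∈ I_t` -/
  reward : ℕ → Fin N → Ω → ℝ

/-- `I` maximizes the total weight `∑_{i ∈ I} w i` among the super arms in `A`. -/
def IsArgmax {N : ℕ} (A : Finset (Finset (Fin N))) (w : Fin N → ℝ) (I : Finset (Fin N)) : Prop :=
  I ∈ A ∧ ∀ J ∈ A, ∑ i ∈ J, w i ≤ ∑ i ∈ I, w i

namespace Run

variable {Ω : Type*} {d N : ℕ}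

/-- `V_0 = lam • I` and `V_t = V_{t-1} + ∑_{i ∈ I_t} x_t(i) x_t(i)ᵀ`. -/
def V (P : Run Ω d N) (lam : ℝ) : ℕ → Ω → Matrix (Fin d) (Fin d) ℝ
  | 0, _ => lam • (1 : Matrix (Fin d) (Fin d) ℝ)
  | t + 1, ω => P.V lam t ω + ∑ i ∈ P.play (t + 1) ω,
      Matrix.vecMulVec (P.feature (t + 1) i ω).ofLp (P.feature (t + 1) i ω).ofLp

/-- `b_0 = 0` and `b_t = b_{t-1} + ∑_{i ∈ I_t} r_t(i) x_t(i)`. -/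
def b (P : Run Ω d N) : ℕ → Ω → Vec d
  | 0, _ => 0
  | t + 1, ω => P.b t ω + ∑ i ∈ P.play (t + 1) ω,
      P.reward (t + 1) i ω • P.feature (t + 1) i ω

/-- The estimator `θ̂_t = V_{t-1}⁻¹ b_{t-1}` of round `t ≥ 1`. -/
def thetaHat (P : Run Ω d N) (lam : ℝ) (t : ℕ) (ω : Ω) : Vec d :=
  WithLp.toLp 2 (Matrix.mulVec (P.V lam (t - 1) ω)⁻¹ (P.b (t - 1) ω).ofLp)

/-- The reward of arm `i` in round `t` as the learner sees it: hidden (set to `0`) unless the arm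
is played. -/
def seen (P : Run Ω d N) (t : ℕ) (i : Fin N) (ω : Ω) : ℝ :=
  if i ∈ P.play t ω then P.reward t i ω else 0

/-- The noise `η_t(i) = r_t(i) - ⟨θ*, x_t(i)⟩`. -/
def noise (P : Run Ω d N) (θ : Vec d) (t : ℕ) (i : Fin N) (ω : Ω) : ℝ :=
  P.reward t i ω - inner ℝ θ (P.feature t i ω)

/-- The history before the rewards of round `t` are observed: generated by the features and the
plays of the rounds `1, …, t` and by the observed rewards of the rounds `1, …, t - 1`. -/
@[reducible]
def history (P : Run Ω d N) (t : ℕ) : MeasurableSpace Ω :=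
  (⨆ s ∈ Finset.Icc 1 t,
    ((⨆ i, MeasurableSpace.comap (P.feature s i) inferInstance) ⊔
      MeasurableSpace.comap (P.play s) inferInstance)) ⊔
  (⨆ s ∈ Finset.Icc 1 (t - 1), ⨆ i, MeasurableSpace.comap (P.seen s i) inferInstance)

/-- What the learner knows when the parameter of round `t` is sampled: the features and the
available super arms of the rounds `1, …, t`, and the plays and the observed rewards of the rounds
`1, …, t - 1`. -/
@[reducible]
def info (P : Run Ω d N) (t : ℕ) : MeasurableSpace Ω :=
  (⨆ s ∈ Finset.Icc 1 t,
    ((⨆ i, MeasurableSpace.comap (P.feature s i) inferInstance) ⊔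
      MeasurableSpace.comap (P.avail s) inferInstance)) ⊔
  (⨆ s ∈ Finset.Icc 1 (t - 1),
    (MeasurableSpace.comap (P.play s) inferInstance ⊔
      ⨆ i, MeasurableSpace.comap (P.seen s i) inferInstance))

/-- The regret over `T` rounds of the plays `I_t` against the super arms `best t`. -/
def regret (P : Run Ω d N) (θ : Vec d) (best : ℕ → Ω → Finset (Fin N)) (T : ℕ) (ω : Ω) : ℝ :=
  ∑ t ∈ Finset.Icc 1 T,
    (∑ i ∈ best t ω, inner ℝ θ (P.feature t i ω) -
      ∑ i ∈ P.play t ω, inner ℝ θ (P.feature t i ω))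

end Run

/-- `beta d k R S lam δ t = R √(d log((1 + k t / lam) / δ)) + √lam S`. -/
def beta (d k : ℕ) (R S lam δ : ℝ) (t : ℕ) : ℝ :=
  R * Real.sqrt (d * Real.log ((1 + k * t / lam) / δ)) + Real.sqrt lam * S

/-- The combinatorial linear semi-bandit environment: at most `k` arms per super arm, features of
norm at most `1`, a parameter `θ` of norm at most `S`, rewards with conditional mean `⟨θ, x_t(i)⟩`,
and conditionally `R`-sub-Gaussian noise. The noise vector of a round is sub-Gaussian jointly in
the arms, which for one arm (`c` supported at `i`) is the usual condition, and which holds whenever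
the noises of a round are conditionally independent and each is conditionally `R`-sub-Gaussian. -/
structure IsEnvironment {Ω : Type*} [MeasurableSpace Ω] (μ : Measure Ω) {d N : ℕ}
    (P : Run Ω d N) (k T : ℕ) (R S : ℝ) (θ : Vec d) : Prop where
  measurable_feature : ∀ t ∈ Finset.Icc 1 T, ∀ i, Measurable (P.feature t i)
  measurable_avail : ∀ t ∈ Finset.Icc 1 T, Measurable (P.avail t)
  measurable_reward : ∀ t ∈ Finset.Icc 1 T, ∀ i, Measurable (P.reward t i)
  card_le : ∀ t ∈ Finset.Icc 1 T, ∀ ω, ∀ I ∈ P.avail t ω, I.card ≤ k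
  norm_param_le : ‖θ‖ ≤ S
  norm_feature_le : ∀ t ∈ Finset.Icc 1 T, ∀ i ω, ‖P.feature t i ω‖ ≤ 1
  integrable_reward : ∀ t ∈ Finset.Icc 1 T, ∀ i, Integrable (P.reward t i) μ
  mean_reward : ∀ t ∈ Finset.Icc 1 T, ∀ i,
    μ[P.reward t i | P.history t] =ᵐ[μ] fun ω => inner ℝ θ (P.feature t i ω)
  integrable_exp_noise : ∀ t ∈ Finset.Icc 1 T, ∀ c : Fin N → ℝ,
    Integrable (fun ω => Real.exp (∑ i, c i * P.noise θ t i ω)) μ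
  subGaussian_noise : ∀ t ∈ Finset.Icc 1 T, ∀ c : Fin N → ℝ,
    μ[fun ω => Real.exp (∑ i, c i * P.noise θ t i ω) | P.history t] ≤ᵐ[μ]
      fun _ => Real.exp (R ^ 2 * (∑ i, c i ^ 2) / 2)

/-- The learner is Thompson sampling with round-wise randomization, with parameters `lam` and
`v_t`: given what is known at the beginning of round `t`, the parameter `θ̃_t` has the law
`𝒩(θ̂_t, v_t² V_{t-1}⁻¹)`, and the play `I_t ∈ S_t` maximizes the sum of the estimated rewards
`⟨θ̃_t, x_t(i)⟩` (ties may be broken in any way). -/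
structure IsRoundwiseTS {Ω : Type*} [MeasurableSpace Ω] (μ : Measure Ω) {d N : ℕ}
    (P : Run Ω d N) (T : ℕ) (lam : ℝ) (v : ℕ → ℝ) : Prop where
  measurable_sample : ∀ t ∈ Finset.Icc 1 T, Measurable (P.sample t)
  measurable_play : ∀ t ∈ Finset.Icc 1 T, Measurable (P.play t)
  law_sample : ∀ t ∈ Finset.Icc 1 T, ∀ B : Set (Vec d), MeasurableSet B →
    μ⟦P.sample t ⁻¹' B | P.info t⟧ =ᵐ[μ] fun ω =>
      (multivariateGaussian (P.thetaHat lam t ω) ((v t) ^ 2 • (P.V lam (t - 1) ω)⁻¹)).real B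
  play_argmax : ∀ t ∈ Finset.Icc 1 T, ∀ ω,
    IsArgmax (P.avail t ω) (fun i => inner ℝ (P.sample t ω) (P.feature t i ω)) (P.play t ω)

end CLS

end

/-!
The regret of a round splits into the loss of optimism `⟨θ*, X_best⟩ - ⟨θ̃_t, X_play⟩` and the error
`⟨θ̃_t - θ*, X_play⟩`, where `X_J` is the sum of the features of the super arm `J`. Everything is
measured by the width of the play, the norm of `X_play` for `V_{t-1}⁻¹`.

*Concentration.* In every direction the noise yields an exponential supermartingale
(`lintegral_exp_noiseSum_le`). Mixing these over a Gaussian direction shows that `θ*` is within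
`2 v_t` of `θ̂_t` for the norm of `V_{t-1}` (`measure_thetaHat_tail_le`); the crude bound
`V_n ≤ lam + k n` on the matrix replaces the usual determinant. Gaussian tails put `θ̃_t` within
`γ = v_t √d a` of `θ̂_t`, with `a` of logarithmic size (`measure_sample_tail_le`). Hence the error
is at most `γ + 2 v_t` times the width.

*Optimism.* Compare `θ̃_t` with an independent copy `θ'` of itself. With probability bounded below,
`θ'` exceeds its mean by two standard deviations in the direction `X_best` and is within `γ` of
`θ̂_t`; then `⟨θ', X_J⟩ ≥ ⟨θ*, X_best⟩` for every `J` optimal for `θ'`, and the loss of optimism is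
at most `⟨θ' - θ̃_t, X_J⟩ ≤ 2 γ ‖X_J‖` (`optimism`). Averaging over `θ'` bounds the loss by a
multiple of the conditional mean of the width of the play. As ties are broken arbitrarily, the play
is not a function of the sample; the smallest width among the optimal super arms, `argmaxWidth`, is
one, and it is at most the width of the play (`ae_integral_argmaxWidth_le`).

*Summation.* Since widths are bounded by `k / √lam`, an exponential supermartingale bounds the sum
of the conditional means by twice the sum of the widths plus `2 k / √lam` times a logarithm
(`measure_sum_condExp_le`). The sum of the widths is controlled by the elliptical potential
(`Run.sum_wnorm_V_inv_sq_le`). As up to `k` features enter `V` in one round while the norm is the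
one from before the round, this costs a factor `1 + k / lam`, and the sum of the widths is of order
`√(d k T (1 + k / lam))` up to logarithms: `√(d k² T / lam)` for `lam ≤ k`, and `√(d k T)` for
`lam ≥ k`.
-/

noncomputable section

namespace CLS

open Matrix
open scoped MatrixOrder ENNReal

/-! ### Norms attached to positive definite matrices -/

section

variable {d : ℕ}

/-- The seminorm `x ↦ √(xᵀ V x)` attached to a (positive semidefinite) matrix `V`. -/
def wnorm (V : Matrix (Fin d) (Fin d) ℝ) (x : Vec d) : ℝ := √(x.ofLp ⬝ᵥ V *ᵥ x.ofLp)

lemma wnorm_nonneg (V : Matrix (Fin d) (Fin d) ℝ) (x : Vec d) : 0 ≤ wnorm V x := Real.sqrt_nonneg _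

lemma wnorm_sq {V : Matrix (Fin d) (Fin d) ℝ} (hV : V.PosSemidef) (x : Vec d) :
    wnorm V x ^ 2 = x.ofLp ⬝ᵥ V *ᵥ x.ofLp :=
  Real.sq_sqrt (by simpa using hV.dotProduct_mulVec_nonneg x.ofLp)

/-- A positive definite `V` factors as `B * B` with `B` symmetric and invertible; in the coordinates
given by `B` and `A = B⁻¹`, the seminorms of `V` and of `V⁻¹` become the Euclidean norm. -/
lemma exists_factor {V : Matrix (Fin d) (Fin d) ℝ} (hV : V.PosDef) :
    ∃ B A : Vec d →L[ℝ] Vec d, (∀ x, A (B x) = x) ∧ (∀ x, B (A x) = x) ∧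
      (∀ u, wnorm V u = ‖B u‖) ∧ (∀ x, wnorm V⁻¹ x = ‖A x‖) ∧
      ∀ u x, inner ℝ u x = inner ℝ (B u) (A x) := by
  set Q := CFC.sqrt V with hQ
  have hQQ : Q * Q = V := CFC.sqrt_mul_sqrt_self V hV.posSemidef.nonneg
  have hQs : Qᴴ = Q := (CFC.sqrt_nonneg V).isSelfAdjoint
  have hdet : IsUnit Q.det := by
    have h := hV.det_pos.ne'
    rw [← hQQ, det_mul] at h
    exact (left_ne_zero_of_mul h).isUnit
  have hQis : (Q⁻¹)ᴴ = Q⁻¹ := by rw [conjTranspose_nonsing_inv, hQs]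
  have hinv : Q⁻¹ * Q⁻¹ = V⁻¹ := by rw [← Matrix.mul_inv_rev, hQQ]
  have hn : ∀ M W : Matrix (Fin d) (Fin d) ℝ, Mᴴ = M → M * M = W → ∀ u,
      wnorm W u = ‖toEuclideanCLM (𝕜 := ℝ) M u‖ := by
    intro M W hM hMW u
    rw [wnorm, ← inner_toEuclideanCLM, ← hMW, map_mul, mul_apply_eq_comp]
    have : star (toEuclideanCLM (𝕜 := ℝ) M) = toEuclideanCLM (𝕜 := ℝ) M := by
      rw [← map_star, star_eq_conjTranspose, hM]
    nth_rewrite 1 [← this]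
    rw [ContinuousLinearMap.star_eq_adjoint, ContinuousLinearMap.adjoint_inner_right,
      real_inner_self_eq_norm_sq, Real.sqrt_sq (norm_nonneg _)]
  have hAB : ∀ x, toEuclideanCLM (𝕜 := ℝ) Q⁻¹ (toEuclideanCLM (𝕜 := ℝ) Q x) = x := by
    intro x
    rw [← mul_apply_eq_comp, ← map_mul, nonsing_inv_mul _ hdet, map_one]; rfl
  have hBA : ∀ x, toEuclideanCLM (𝕜 := ℝ) Q (toEuclideanCLM (𝕜 := ℝ) Q⁻¹ x) = x := by
    intro x
    rw [← mul_apply_eq_comp, ← map_mul, mul_nonsing_inv _ hdet, map_one]; rfl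
  refine ⟨toEuclideanCLM (𝕜 := ℝ) Q, toEuclideanCLM (𝕜 := ℝ) Q⁻¹, hAB, hBA,
    hn _ _ hQs hQQ, hn _ _ hQis hinv, fun u x => ?_⟩
  have : star (toEuclideanCLM (𝕜 := ℝ) Q) = toEuclideanCLM (𝕜 := ℝ) Q := by
    rw [← map_star, star_eq_conjTranspose, hQs]
  calc inner ℝ u x = inner ℝ u (toEuclideanCLM (𝕜 := ℝ) Q (toEuclideanCLM (𝕜 := ℝ) Q⁻¹ x)) := by
        rw [hBA]
    _ = inner ℝ (star (toEuclideanCLM (𝕜 := ℝ) Q) u) (toEuclideanCLM (𝕜 := ℝ) Q⁻¹ x) := by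
        rw [ContinuousLinearMap.star_eq_adjoint, ContinuousLinearMap.adjoint_inner_left]
    _ = _ := by rw [this]

section
variable {V W : Matrix (Fin d) (Fin d) ℝ}

lemma inner_le_wnorm_mul (hV : V.PosDef) (u x : Vec d) :
    inner ℝ u x ≤ wnorm V u * wnorm V⁻¹ x := by
  obtain ⟨B, A, -, -, h1, h2, h3⟩ := exists_factor hV
  rw [h1, h2, h3]; exact real_inner_le_norm _ _

lemma wnorm_sub_le (hV : V.PosDef) (u x : Vec d) : wnorm V (u - x) ≤ wnorm V u + wnorm V x := by
  obtain ⟨B, A, -, -, h1, -, -⟩ := exists_factor hV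
  rw [h1, h1, h1, map_sub]; exact norm_sub_le _ _

lemma wnorm_smul (hV : V.PosDef) (a : ℝ) (x : Vec d) : wnorm V (a • x) = |a| * wnorm V x := by
  obtain ⟨B, A, -, -, h1, -, -⟩ := exists_factor hV
  rw [h1, h1, map_smul, norm_smul, Real.norm_eq_abs]

lemma wnorm_sum_le (hV : V.PosDef) {ι : Type*} (I : Finset ι) (x : ι → Vec d) :
    wnorm V (∑ i ∈ I, x i) ≤ ∑ i ∈ I, wnorm V (x i) := by
  obtain ⟨B, A, -, -, h1, -, -⟩ := exists_factor hV
  simp only [h1, map_sum]; exact norm_sum_le _ _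

/-- The vector `u = V⁻¹ x` attains equality in `inner_le_wnorm_mul`. -/
lemma wnorm_inv_mulVec (hV : V.PosDef) (x : Vec d) :
    wnorm V (WithLp.toLp 2 (V⁻¹ *ᵥ x.ofLp)) = wnorm V⁻¹ x ∧
      inner ℝ (WithLp.toLp 2 (V⁻¹ *ᵥ x.ofLp)) x = wnorm V⁻¹ x ^ 2 := by
  have hu : IsUnit V.det := hV.det_pos.ne'.isUnit
  constructor
  · rw [wnorm, wnorm, mulVec_mulVec, mul_nonsing_inv _ hu, one_mulVec, dotProduct_comm]
  · rw [wnorm_sq hV.inv.posSemidef, EuclideanSpace.inner_eq_star_dotProduct]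
    simp

/-- Inversion reverses the order of the seminorms. -/
lemma wnorm_inv_le (hV : V.PosDef) (hW : W.PosDef) {c : ℝ}
    (h : ∀ u, wnorm W u ≤ c * wnorm V u) (x : Vec d) : wnorm V⁻¹ x ≤ c * wnorm W⁻¹ x := by
  obtain ⟨h1, h2⟩ := wnorm_inv_mulVec hV x
  set u : Vec d := WithLp.toLp 2 (V⁻¹ *ᵥ x.ofLp)
  have h3 : wnorm V⁻¹ x ^ 2 ≤ (c * wnorm V⁻¹ x) * wnorm W⁻¹ x := by
    rw [← h2]
    refine (inner_le_wnorm_mul hW u x).trans ?_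
    gcongr
    · exact wnorm_nonneg _ _
    · rw [← h1]; exact h u
  rcases (wnorm_nonneg V⁻¹ x).eq_or_lt with h0 | h0
  · obtain ⟨h1', h2'⟩ := wnorm_inv_mulVec hW x
    set u' : Vec d := WithLp.toLp 2 (W⁻¹ *ᵥ x.ofLp)
    have h4 := inner_le_wnorm_mul hV u' x
    rw [← h0, mul_zero, h2'] at h4
    have : wnorm W⁻¹ x = 0 := by nlinarith [wnorm_nonneg W⁻¹ x]
    rw [← h0, this, mul_zero]
  · nlinarith

/-- If the seminorm of `V` dominates `√a` times the Euclidean norm, then that of `V⁻¹` is at most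
the Euclidean norm divided by `√a`. -/
lemma wnorm_inv_le_norm (hV : V.PosDef) {a : ℝ} (ha : 0 < a)
    (h : ∀ u : Vec d, a * ‖u‖ ^ 2 ≤ wnorm V u ^ 2) (x : Vec d) : wnorm V⁻¹ x ≤ ‖x‖ / √a := by
  obtain ⟨h1, h2⟩ := wnorm_inv_mulVec hV x
  set u : Vec d := WithLp.toLp 2 (V⁻¹ *ᵥ x.ofLp)
  have h3 : √a * ‖u‖ ≤ wnorm V⁻¹ x := by
    rw [← h1]
    refine (sq_le_sq₀ (by positivity) (wnorm_nonneg _ _)).1 ?_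
    rw [mul_pow, Real.sq_sqrt ha.le]; exact h u
  have h4 : wnorm V⁻¹ x ^ 2 ≤ ‖u‖ * ‖x‖ := by rw [← h2]; exact real_inner_le_norm _ _
  have hs : 0 < √a := Real.sqrt_pos.2 ha
  rw [le_div_iff₀ hs]
  rcases (wnorm_nonneg V⁻¹ x).eq_or_lt with h0 | h0
  · rw [← h0]; simp
  · have h5 : wnorm V⁻¹ x * (wnorm V⁻¹ x * √a) ≤ wnorm V⁻¹ x * ‖x‖ := by
      nlinarith [norm_nonneg x]
    exact le_of_mul_le_mul_left h5 h0

lemma wnorm_sq_add_vecMulVec (hV : V.PosSemidef) (x u : Vec d) :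
    wnorm (V + vecMulVec x.ofLp x.ofLp) u ^ 2 = wnorm V u ^ 2 + inner ℝ u x ^ 2 := by
  rw [wnorm_sq hV, wnorm_sq, add_mulVec, dotProduct_add, EuclideanSpace.inner_eq_star_dotProduct]
  · rw [vecMulVec_mulVec]
    simp only [star_trivial, dotProduct_smul, MulOpposite.smul_eq_mul_unop, MulOpposite.unop_op]
    rw [dotProduct_comm u.ofLp x.ofLp]; ring
  · exact hV.add (by simpa using posSemidef_vecMulVec_self_star x.ofLp)

lemma det_add_vecMulVec (hV : V.PosDef) (x : Vec d) :
    (V + vecMulVec x.ofLp x.ofLp).det = V.det * (1 + wnorm V⁻¹ x ^ 2) := by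
  have h := det_add_replicateCol_mul_replicateRow (ι := Unit) hV.det_pos.ne'.isUnit x.ofLp x.ofLp
  rw [← vecMulVec_eq] at h
  rw [h, wnorm_sq hV.inv.posSemidef]
  congr 1
  rw [det_unique]
  simp [Matrix.mul_apply, dotProduct, mulVec, Finset.mul_sum, Finset.sum_mul]
  rw [Finset.sum_comm]
  simp [mul_assoc]

/-- The determinant is the product of the eigenvalues, each of which is at most `c`. -/
lemma det_le_pow (hV : V.PosDef) {c : ℝ} (h : ∀ u : Vec d, wnorm V u ^ 2 ≤ c * ‖u‖ ^ 2) :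
    V.det ≤ c ^ d := by
  rw [hV.isHermitian.det_eq_prod_eigenvalues]
  calc ∏ i, ((hV.isHermitian.eigenvalues i : ℝ)) ≤ ∏ _i : Fin d, c := by
        refine Finset.prod_le_prod (fun i _ => (hV.eigenvalues_pos i).le) fun i _ => ?_
        rw [hV.isHermitian.eigenvalues_eq]
        have := h (hV.isHermitian.eigenvectorBasis i)
        rw [wnorm_sq hV.posSemidef] at this
        simpa using this
    _ = c ^ d := by simp

end

end

/-! ### The elliptical potential -/

section

variable {d : ℕ}

lemma posDef_add_sum_vecMulVec {V : Matrix (Fin d) (Fin d) ℝ} (hV : V.PosDef) {ι : Type*}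
    (I : Finset ι) (x : ι → Vec d) :
    (V + ∑ i ∈ I, vecMulVec (x i).ofLp (x i).ofLp).PosDef :=
  hV.add_posSemidef (posSemidef_sum _ fun i _ => by
    simpa using posSemidef_vecMulVec_self_star (x i).ofLp)

lemma wnorm_sq_add_sum_vecMulVec {V : Matrix (Fin d) (Fin d) ℝ} (hV : V.PosDef) {ι : Type*}
    (I : Finset ι) (x : ι → Vec d) (u : Vec d) :
    wnorm (V + ∑ i ∈ I, vecMulVec (x i).ofLp (x i).ofLp) u ^ 2 =
      wnorm V u ^ 2 + ∑ i ∈ I, inner ℝ u (x i) ^ 2 := by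
  classical
  induction I using Finset.induction_on with
  | empty => simp
  | insert j J hj ih =>
    rw [Finset.sum_insert hj, Finset.sum_insert hj, add_left_comm, add_comm (vecMulVec _ _),
      wnorm_sq_add_vecMulVec (posDef_add_sum_vecMulVec hV J x).posSemidef, ih]
    ring

lemma sum_inner_sq_le {ι : Type*} (I : Finset ι) (x : ι → Vec d) (hx : ∀ i ∈ I, ‖x i‖ ≤ 1)
    {k : ℕ} (hI : I.card ≤ k) (u : Vec d) : ∑ i ∈ I, inner ℝ u (x i) ^ 2 ≤ k * ‖u‖ ^ 2 := by
  calc ∑ i ∈ I, inner ℝ u (x i) ^ 2 ≤ ∑ _i ∈ I, ‖u‖ ^ 2 := by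
        refine Finset.sum_le_sum fun i hi => ?_
        rw [← sq_abs (inner ℝ u (x i))]
        have h := abs_real_inner_le_norm u (x i)
        have h2 : ‖u‖ * ‖x i‖ ≤ ‖u‖ := mul_le_of_le_one_right (norm_nonneg _) (hx i hi)
        exact pow_le_pow_left₀ (abs_nonneg _) (h.trans h2) 2
    _ = I.card * ‖u‖ ^ 2 := by simp
    _ ≤ k * ‖u‖ ^ 2 := by gcongr

/-- One round of the elliptical potential argument. The weights are those of `V`, before the round,
although `k` vectors are added in the round; the factor `1 + k / lam` bounds the growth of the
seminorm within the round. -/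
lemma sum_wnorm_inv_sq_le_log_det {V : Matrix (Fin d) (Fin d) ℝ} (hV : V.PosDef) {lam : ℝ}
    (hlam : 1 ≤ lam) (hVl : ∀ u : Vec d, lam * ‖u‖ ^ 2 ≤ wnorm V u ^ 2) {ι : Type*}
    (I : Finset ι) (x : ι → Vec d) (hx : ∀ i ∈ I, ‖x i‖ ≤ 1) {k : ℕ} (hI : I.card ≤ k) :
    ∑ i ∈ I, wnorm V⁻¹ (x i) ^ 2 ≤ 2 * (1 + k / lam) *
      (Real.log (V + ∑ i ∈ I, vecMulVec (x i).ofLp (x i).ofLp).det - Real.log V.det) := by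
  classical
  induction I using Finset.induction_on with
  | empty => simp
  | insert j J hj ih =>
    have hx' : ∀ i ∈ J, ‖x i‖ ≤ 1 := fun i hi => hx i (Finset.mem_insert_of_mem hi)
    have hJ : J.card ≤ k := (Finset.card_le_card (Finset.subset_insert j J)).trans hI
    have ih := ih hx' hJ
    rw [Finset.sum_insert hj, Finset.sum_insert hj, add_left_comm V, add_comm (vecMulVec _ _)]
    have hW := posDef_add_sum_vecMulVec hV J x
    have hWq := wnorm_sq_add_sum_vecMulVec hV J x
    set W := V + ∑ i ∈ J, vecMulVec (x i).ofLp (x i).ofLp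
    have hl0 : 0 < lam := by linarith
    have hc0 : 0 ≤ 1 + k / lam := by positivity
    have h1 : wnorm V⁻¹ (x j) ^ 2 ≤ (1 + k / lam) * wnorm W⁻¹ (x j) ^ 2 := by
      have : wnorm V⁻¹ (x j) ≤ √(1 + k / lam) * wnorm W⁻¹ (x j) := by
        refine wnorm_inv_le hV hW (fun u => ?_) _
        refine (sq_le_sq₀ (wnorm_nonneg _ _)
          (mul_nonneg (Real.sqrt_nonneg _) (wnorm_nonneg _ _))).1 ?_
        rw [mul_pow, Real.sq_sqrt hc0, hWq]
        have h2 := sum_inner_sq_le J x hx' hJ u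
        have h3 : (k : ℝ) * ‖u‖ ^ 2 ≤ k / lam * wnorm V u ^ 2 := by
          rw [div_mul_eq_mul_div, le_div_iff₀ hl0]
          nlinarith [hVl u, (Nat.cast_nonneg k : (0 : ℝ) ≤ k)]
        linarith
      have := pow_le_pow_left₀ (wnorm_nonneg _ _) this 2
      rwa [mul_pow, Real.sq_sqrt hc0] at this
    have h2 : wnorm W⁻¹ (x j) ^ 2 ≤ 1 := by
      have : wnorm W⁻¹ (x j) ≤ ‖x j‖ / √lam := by
        refine wnorm_inv_le_norm hW hl0 (fun u => ?_) _
        rw [hWq]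
        have := hVl u
        have h0 : 0 ≤ ∑ i ∈ J, inner ℝ u (x i) ^ 2 := Finset.sum_nonneg fun _ _ => sq_nonneg _
        linarith
      have h3 : ‖x j‖ / √lam ≤ 1 := by
        rw [div_le_one (Real.sqrt_pos.2 hl0)]
        exact (hx j (Finset.mem_insert_self _ _)).trans (Real.one_le_sqrt.2 hlam)
      exact pow_le_one₀ (wnorm_nonneg _ _) (this.trans h3)
    rw [det_add_vecMulVec hW, Real.log_mul hW.det_pos.ne' (by positivity)]
    set q := wnorm W⁻¹ (x j) ^ 2 with hq
    have hq0 : 0 ≤ q := sq_nonneg _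
    have h3 : q ≤ 2 * Real.log (1 + q) := by
      have h4 := Real.one_sub_inv_le_log_of_pos (show 0 < 1 + q by linarith)
      have h5 : q / 2 ≤ 1 - (1 + q)⁻¹ := by
        rw [le_sub_iff_add_le, ← le_sub_iff_add_le', inv_le_iff_one_le_mul₀ (by linarith)]
        nlinarith
      linarith
    have h4 : (1 + k / lam) * q ≤ (1 + k / lam) * (2 * Real.log (1 + q)) := by gcongr
    linarith

namespace Run

variable {Ω : Type*} {N : ℕ}

lemma V_posDef (P : Run Ω d N) {lam : ℝ} (hlam : 0 < lam) (n : ℕ) (ω : Ω) :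
    (P.V lam n ω).PosDef := by
  induction n with
  | zero => exact PosDef.one.smul hlam
  | succ n ih => exact posDef_add_sum_vecMulVec ih _ _

lemma wnorm_V_sq (P : Run Ω d N) {lam : ℝ} (hlam : 0 < lam) (n : ℕ) (ω : Ω) (u : Vec d) :
    wnorm (P.V lam n ω) u ^ 2 = lam * ‖u‖ ^ 2 +
      ∑ s ∈ Finset.Icc 1 n, ∑ i ∈ P.play s ω, inner ℝ u (P.feature s i ω) ^ 2 := by
  induction n with
  | zero =>
    rw [wnorm_sq (P.V_posDef hlam 0 ω).posSemidef, Run.V, smul_mulVec, one_mulVec,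
      EuclideanSpace.real_norm_sq_eq]
    simp [dotProduct, Finset.mul_sum, sq]
    refine Finset.sum_congr rfl fun i _ => by ring
  | succ n ih =>
    rw [Finset.sum_Icc_succ_top (by omega), Run.V,
      wnorm_sq_add_sum_vecMulVec (P.V_posDef hlam n ω), ih]
    ring

lemma le_wnorm_V_sq (P : Run Ω d N) {lam : ℝ} (hlam : 0 < lam) (n : ℕ) (ω : Ω) (u : Vec d) :
    lam * ‖u‖ ^ 2 ≤ wnorm (P.V lam n ω) u ^ 2 := by
  rw [wnorm_V_sq P hlam]
  exact le_add_of_nonneg_right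
    (Finset.sum_nonneg fun _ _ => Finset.sum_nonneg fun _ _ => sq_nonneg _)

/-- Regularity of the first `n` rounds at `ω`: features in the unit ball, at most `k` plays. -/
def Bounded (P : Run Ω d N) (k n : ℕ) (ω : Ω) : Prop :=
  ∀ s ∈ Finset.Icc 1 n, (P.play s ω).card ≤ k ∧ ∀ i, ‖P.feature s i ω‖ ≤ 1

lemma Bounded.mono {P : Run Ω d N} {k n m : ℕ} {ω : Ω} (h : P.Bounded k n ω) (hmn : m ≤ n) :
    P.Bounded k m ω :=
  fun s hs => h s (Finset.Icc_subset_Icc_right hmn hs)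

lemma wnorm_V_sq_le {P : Run Ω d N} {k n : ℕ} {ω : Ω} (h : P.Bounded k n ω) {lam : ℝ}
    (hlam : 0 < lam) (u : Vec d) :
    wnorm (P.V lam n ω) u ^ 2 ≤ (lam + k * n) * ‖u‖ ^ 2 := by
  rw [wnorm_V_sq P hlam, add_mul]
  gcongr
  calc _ ≤ ∑ s ∈ Finset.Icc 1 n, k * ‖u‖ ^ 2 :=
        Finset.sum_le_sum fun s hs => sum_inner_sq_le _ _ (fun i _ => (h s hs).2 i) (h s hs).1 u
    _ = k * n * ‖u‖ ^ 2 := by simp; ring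

lemma wnorm_V_inv_le (P : Run Ω d N) {lam : ℝ} (hlam : 0 < lam) (n : ℕ) (ω : Ω) (x : Vec d) :
    wnorm (P.V lam n ω)⁻¹ x ≤ ‖x‖ / √lam :=
  wnorm_inv_le_norm (P.V_posDef hlam n ω) hlam (P.le_wnorm_V_sq hlam n ω) x

/-- The elliptical potential lemma. -/
lemma sum_wnorm_V_inv_sq_le {P : Run Ω d N} {k T : ℕ} {ω : Ω} (h : P.Bounded k T ω) {lam : ℝ}
    (hlam : 1 ≤ lam) :
    ∑ t ∈ Finset.Icc 1 T, ∑ i ∈ P.play t ω,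
      wnorm (P.V lam (t - 1) ω)⁻¹ (P.feature t i ω) ^ 2 ≤
      2 * (1 + k / lam) * (d * Real.log (1 + k * T / lam)) := by
  have hl0 : 0 < lam := by linarith
  have key : ∀ n ≤ T, ∑ t ∈ Finset.Icc 1 n, ∑ i ∈ P.play t ω,
      wnorm (P.V lam (t - 1) ω)⁻¹ (P.feature t i ω) ^ 2 ≤ 2 * (1 + k / lam) *
        (Real.log (P.V lam n ω).det - Real.log (P.V lam 0 ω).det) := by
    intro n
    induction n with
    | zero => intro _; simp
    | succ n ih =>
      intro hn
      rw [Finset.sum_Icc_succ_top (by omega)]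
      have h1 := ih (by omega)
      have hs := h (n + 1) (Finset.mem_Icc.2 ⟨by omega, hn⟩)
      have h2 : ∑ i ∈ P.play (n + 1) ω,
          wnorm (P.V lam n ω)⁻¹ (P.feature (n + 1) i ω) ^ 2 ≤ 2 * (1 + k / lam) *
            (Real.log (P.V lam (n + 1) ω).det - Real.log (P.V lam n ω).det) :=
        sum_wnorm_inv_sq_le_log_det (P.V_posDef hl0 n ω) hlam (P.le_wnorm_V_sq hl0 n ω)
        (P.play (n + 1) ω) (fun i => P.feature (n + 1) i ω) (fun i _ => hs.2 i) hs.1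
      rw [Nat.add_sub_cancel]
      linarith
  refine (key T le_rfl).trans ?_
  gcongr
  have h0 : (P.V lam 0 ω).det = lam ^ d := by simp [Run.V]
  have hT := det_le_pow (P.V_posDef hl0 T ω) (wnorm_V_sq_le h hl0)
  have h1 := Real.log_le_log (P.V_posDef hl0 T ω).det_pos hT
  rw [h0, Real.log_pow]
  rw [Real.log_pow] at h1
  have h2 : Real.log (1 + k * T / lam) = Real.log (lam + k * T) - Real.log lam := by
    rw [← Real.log_div (by positivity) hl0.ne']
    congr 1; field_simp
  rw [h2]; linarith

/-- The accumulated noise `∑_{s ≤ n} ∑_{i ∈ I_s} η_s(i) x_s(i)`. -/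
def noiseSum (P : Run Ω d N) (θ : Vec d) (n : ℕ) (ω : Ω) : Vec d :=
  ∑ s ∈ Finset.Icc 1 n, ∑ i ∈ P.play s ω, P.noise θ s i ω • P.feature s i ω

lemma b_eq_V_mulVec_add (P : Run Ω d N) (θ : Vec d) (lam : ℝ) (n : ℕ) (ω : Ω) :
    P.b n ω = WithLp.toLp 2 (P.V lam n ω *ᵥ θ.ofLp) + (P.noiseSum θ n ω - lam • θ) := by
  induction n with
  | zero =>
    ext j
    simp [Run.b, Run.V, noiseSum, smul_mulVec]
  | succ n ih =>
    have h1 : P.noiseSum θ (n + 1) ω = P.noiseSum θ n ω +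
        ∑ i ∈ P.play (n + 1) ω, P.noise θ (n + 1) i ω • P.feature (n + 1) i ω := by
      rw [noiseSum, Finset.sum_Icc_succ_top (by omega)]; rfl
    have h2 : WithLp.toLp 2 (P.V lam (n + 1) ω *ᵥ θ.ofLp) =
        WithLp.toLp 2 (P.V lam n ω *ᵥ θ.ofLp) + ∑ i ∈ P.play (n + 1) ω,
          (inner ℝ θ (P.feature (n + 1) i ω) : ℝ) • P.feature (n + 1) i ω := by
      rw [Run.V, add_mulVec, sum_mulVec]
      ext j
      simp [vecMulVec_mulVec, EuclideanSpace.inner_eq_star_dotProduct, Finset.sum_apply]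
    rw [Run.b, ih, h1, h2]
    simp only [Run.noise, sub_smul, Finset.sum_sub_distrib]
    abel

/-- In the norm of `V_n`, the estimation error is the accumulated noise plus the bias of the
regularization. -/
lemma wnorm_thetaHat_sub_le (P : Run Ω d N) (θ : Vec d) {lam S : ℝ} (hlam : 0 < lam)
    (hθ : ‖θ‖ ≤ S) (n : ℕ) (ω : Ω) :
    wnorm (P.V lam n ω) (P.thetaHat lam (n + 1) ω - θ) ≤
      wnorm (P.V lam n ω)⁻¹ (P.noiseSum θ n ω) + √lam * S := by
  have hV := P.V_posDef hlam n ω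
  have h1 : P.thetaHat lam (n + 1) ω - θ =
      WithLp.toLp 2 ((P.V lam n ω)⁻¹ *ᵥ (P.noiseSum θ n ω - lam • θ).ofLp) := by
    rw [Run.thetaHat, Nat.add_sub_cancel, P.b_eq_V_mulVec_add θ lam n ω]
    ext j
    rw [WithLp.ofLp_add, mulVec_add, mulVec_mulVec, nonsing_inv_mul _ hV.det_pos.ne'.isUnit]
    simp
  rw [h1, (wnorm_inv_mulVec hV _).1]
  refine (wnorm_sub_le hV.inv _ _).trans ?_
  rw [wnorm_smul hV.inv, abs_of_pos hlam]
  refine add_le_add le_rfl ?_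
  have h2 : wnorm (P.V lam n ω)⁻¹ θ ≤ S / √lam :=
    (P.wnorm_V_inv_le hlam n ω θ).trans (by gcongr)
  calc lam * wnorm (P.V lam n ω)⁻¹ θ ≤ lam * (S / √lam) := by gcongr
    _ = √lam * S := by
      have := Real.mul_self_sqrt hlam.le
      have h3 := (Real.sqrt_pos.2 hlam).ne'
      field_simp
      rw [sq, this]; ring

/-! ### Measurability of the learner's statistics -/

section Measurability

variable [MeasurableSpace Ω]

/-- The data of the first `n` rounds are measurable. The `σ`-algebra on `Ω` is meant to be
`history` or `info` of a later round. -/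
structure Observed (P : Run Ω d N) (n : ℕ) : Prop where
  feature : ∀ s ∈ Finset.Icc 1 n, ∀ i, Measurable (P.feature s i)
  play : ∀ s ∈ Finset.Icc 1 n, Measurable (P.play s)
  seen : ∀ s ∈ Finset.Icc 1 n, ∀ i, Measurable (P.seen s i)

lemma Observed.mono {P : Run Ω d N} {n m : ℕ} (h : P.Observed n) (hmn : m ≤ n) :
    P.Observed m :=
  have H := Finset.Icc_subset_Icc_right (a := 1) hmn
  ⟨fun s hs => h.feature s (H hs), fun s hs => h.play s (H hs), fun s hs => h.seen s (H hs)⟩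

lemma measurableSet_mem_play {J : Ω → Finset (Fin N)} (hJ : Measurable J) (i : Fin N) :
    MeasurableSet {ω | i ∈ J ω} :=
  hJ (measurableSet_mem_finset i)

lemma measurable_sum_mem {E : Type*} [NormedAddCommGroup E] [MeasurableSpace E] [BorelSpace E]
    [SecondCountableTopology E] {J : Ω → Finset (Fin N)} (hJ : Measurable J) {f : Fin N → Ω → E}
    (hf : ∀ i, Measurable (f i)) : Measurable fun ω => ∑ i ∈ J ω, f i ω := by
  classical
  have : (fun ω => ∑ i ∈ J ω, f i ω) = fun ω => ∑ i, if i ∈ J ω then f i ω else 0 := by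
    funext ω; rw [← Finset.sum_filter]; simp
  rw [this]
  exact Finset.measurable_sum _ fun i _ =>
    Measurable.ite (measurableSet_mem_play hJ i) (hf i) measurable_const

lemma measurable_ofLp_apply {x : Ω → Vec d} (hx : Measurable x) (j : Fin d) :
    Measurable fun ω => (x ω).ofLp j := by
  fun_prop

lemma measurable_toLp_of_apply {x : Ω → Fin d → ℝ} (hx : ∀ j, Measurable fun ω => x ω j) :
    Measurable fun ω => (WithLp.toLp 2 (x ω) : Vec d) := by
  have := measurable_pi_lambda _ hx
  fun_prop

lemma measurable_wnorm {M : Ω → Matrix (Fin d) (Fin d) ℝ}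
    (hM : ∀ i j, Measurable fun ω => M ω i j) {x : Ω → Vec d} (hx : Measurable x) :
    Measurable fun ω => wnorm (M ω) (x ω) := by
  have := measurable_ofLp_apply hx
  simp only [wnorm, dotProduct, mulVec]
  fun_prop

lemma measurable_matrix_inv {M : Ω → Matrix (Fin d) (Fin d) ℝ}
    (hM : ∀ i j, Measurable fun ω => M ω i j) (i j : Fin d) :
    Measurable fun ω => (M ω)⁻¹ i j := by
  have hdet : ∀ M : Ω → Matrix (Fin d) (Fin d) ℝ, (∀ i j, Measurable fun ω => M ω i j) →
      Measurable fun ω => (M ω).det := by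
    intro M hM
    simp only [det_apply]
    fun_prop
  simp only [inv_def, Matrix.smul_apply, adjugate_apply, Ring.inverse_eq_inv', smul_eq_mul]
  refine (hdet M hM).inv.mul (hdet _ fun a b => ?_)
  by_cases h : a = j
  · subst h; simp
  · simp [h, hM]

variable {P : Run Ω d N} {n : ℕ}

lemma Observed.measurable_V (h : P.Observed n) (lam : ℝ) (i j : Fin d) :
    Measurable fun ω => P.V lam n ω i j := by
  induction n with
  | zero => exact measurable_const
  | succ n ih =>
    have hn : n + 1 ∈ Finset.Icc 1 (n + 1) := by simp
    simp only [Run.V, Matrix.add_apply, Matrix.sum_apply, vecMulVec_apply]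
    refine (ih (h.mono (by omega))).add (measurable_sum_mem (h.play _ hn) fun a => ?_)
    have := h.feature _ hn a
    fun_prop

lemma Observed.measurable_V_inv (h : P.Observed n) (lam : ℝ) (i j : Fin d) :
    Measurable fun ω => (P.V lam n ω)⁻¹ i j :=
  measurable_matrix_inv (h.measurable_V lam) i j

lemma Observed.measurable_b (h : P.Observed n) : Measurable (P.b n) := by
  induction n with
  | zero => exact measurable_const
  | succ n ih =>
    have hn : n + 1 ∈ Finset.Icc 1 (n + 1) := by simp
    have h1 : P.b (n + 1) = fun ω => P.b n ω + ∑ i ∈ P.play (n + 1) ω,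
        P.seen (n + 1) i ω • P.feature (n + 1) i ω := by
      funext ω
      rw [Run.b]
      refine congrArg _ (Finset.sum_congr rfl fun i hi => ?_)
      rw [Run.seen, if_pos hi]
    rw [h1]
    exact (ih (h.mono (by omega))).add
      (measurable_sum_mem (h.play _ hn) fun a => (h.seen _ hn a).smul (h.feature _ hn a))

lemma Observed.measurable_thetaHat (h : P.Observed n) (lam : ℝ) :
    Measurable (P.thetaHat lam (n + 1)) := by
  refine measurable_toLp_of_apply fun j => ?_
  exact Finset.measurable_sum Finset.univ fun l _ =>
    (h.measurable_V_inv lam j l).mul (measurable_ofLp_apply h.measurable_b l)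

lemma Observed.measurable_noiseSum (h : P.Observed n) (θ : Vec d) :
    Measurable (P.noiseSum θ n) := by
  have h1 : P.noiseSum θ n = fun ω => ∑ s ∈ Finset.Icc 1 n, ∑ i ∈ P.play s ω,
      (P.seen s i ω - inner ℝ θ (P.feature s i ω)) • P.feature s i ω := by
    funext ω
    refine Finset.sum_congr rfl fun s _ => Finset.sum_congr rfl fun i hi => ?_
    rw [Run.seen, if_pos hi, Run.noise]
  have h2 : ∀ s ∈ Finset.Icc 1 n, ∀ i, Measurable fun ω =>
      (P.seen s i ω - inner ℝ θ (P.feature s i ω)) • P.feature s i ω := by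
    intro s hs i
    have h3 : Measurable fun ω => (inner ℝ θ (P.feature s i ω) : ℝ) :=
      measurable_const.inner (h.feature s hs i)
    exact ((h.seen s hs i).sub h3).smul (h.feature s hs i)
  rw [h1]
  exact Finset.measurable_sum _ fun s hs => measurable_sum_mem (h.play s hs) (h2 s hs)

end Measurability

end Run

end

section

/-! ### Conditional exponential moments -/

section CondExp

variable {Ω : Type*} {m m0 : MeasurableSpace Ω} {μ : Measure Ω}

/-- A bound on a conditional expectation may be tested against any nonnegative measurable weight,
without integrability of the products. -/
lemma lintegral_mul_le_of_condExp_le [IsFiniteMeasure μ] (hm : m ≤ m0) {D g : Ω → ℝ}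
    (hD : Integrable D μ) (hD0 : ∀ ω, 0 ≤ D ω) (hg : Measurable[m] g) (h : μ[D | m] ≤ᵐ[μ] g)
    {M : Ω → ℝ≥0∞} (hM : Measurable[m] M) :
    ∫⁻ ω, M ω * ENNReal.ofReal (D ω) ∂μ ≤ ∫⁻ ω, M ω * ENNReal.ofReal (g ω) ∂μ := by
  have hg' : Measurable g := hg.mono hm le_rfl
  have hM' : Measurable M := hM.mono hm le_rfl
  have hle : (μ.withDensity fun ω => ENNReal.ofReal (D ω)).trim hm ≤
      (μ.withDensity fun ω => ENNReal.ofReal (g ω)).trim hm := by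
    refine Measure.le_iff.2 fun s hs => ?_
    rw [trim_measurableSet_eq hm hs, trim_measurableSet_eq hm hs, withDensity_apply _ (hm s hs),
      withDensity_apply _ (hm s hs),
      ← ofReal_integral_eq_lintegral_ofReal hD.integrableOn (ae_of_all _ hD0),
      ← setIntegral_condExp hm hD hs]
    calc ENNReal.ofReal (∫ ω in s, (μ[D | m]) ω ∂μ)
        ≤ ∫⁻ ω in s, ENNReal.ofReal ((μ[D | m]) ω) ∂μ := by
          rw [integral_eq_lintegral_of_nonneg_ae
            (ae_restrict_of_ae (condExp_nonneg (ae_of_all _ hD0)))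
            integrable_condExp.integrableOn.aestronglyMeasurable]
          exact ENNReal.ofReal_toReal_le
      _ ≤ ∫⁻ ω in s, ENNReal.ofReal (g ω) ∂μ :=
          lintegral_mono_ae (ae_restrict_of_ae (h.mono fun ω hω => ENNReal.ofReal_le_ofReal hω))
  have h1 : ∀ f : Ω → ℝ, AEMeasurable f μ → ∫⁻ ω, M ω * ENNReal.ofReal (f ω) ∂μ =
      ∫⁻ ω, M ω ∂((μ.withDensity fun ω => ENNReal.ofReal (f ω)).trim hm) := by
    intro f hf
    rw [lintegral_trim hm hM, lintegral_withDensity_eq_lintegral_mul₀ hf.ennreal_ofReal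
      hM'.aemeasurable]
    simp only [Pi.mul_apply, mul_comm]
  rw [h1 D hD.aestronglyMeasurable.aemeasurable, h1 g hg'.aemeasurable]
  exact lintegral_mono' hle le_rfl

lemma exists_finite_range_tendsto {α : Type*} [MeasurableSpace α] {N : ℕ} {c : α → Fin N → ℝ}
    (hc : Measurable c) : ∃ f : ℕ → α → Fin N → ℝ, (∀ n, Measurable (f n)) ∧
      (∀ n, (Set.range (f n)).Finite) ∧
      ∀ ω, Filter.Tendsto (fun n => f n ω) Filter.atTop (nhds (c ω)) :=
  have h := hc.stronglyMeasurable
  ⟨fun n => h.approx n, fun n => (h.approx n).measurable, fun n => (h.approx n).finite_range,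
    h.tendsto_approx⟩

/-- A conditionally sub-Gaussian vector stays sub-Gaussian along random directions that are
measurable with respect to the conditioning `σ`-algebra. -/
lemma lintegral_mul_exp_le_of_subGaussian [IsFiniteMeasure μ] (hm : m ≤ m0) {N : ℕ}
    {η : Fin N → Ω → ℝ} {R : ℝ}
    (hint : ∀ c : Fin N → ℝ, Integrable (fun ω => Real.exp (∑ i, c i * η i ω)) μ)
    (hη : ∀ i, Measurable (η i))
    (hsub : ∀ c : Fin N → ℝ, μ[fun ω => Real.exp (∑ i, c i * η i ω) | m] ≤ᵐ[μ]
      fun _ => Real.exp (R ^ 2 * (∑ i, c i ^ 2) / 2))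
    {c : Ω → Fin N → ℝ} (hc : Measurable[m] c) {M : Ω → ℝ≥0∞} (hM : Measurable[m] M) :
    ∫⁻ ω, M ω * ENNReal.ofReal
      (Real.exp (∑ i, c ω i * η i ω - R ^ 2 * (∑ i, c ω i ^ 2) / 2)) ∂μ ≤ ∫⁻ ω, M ω ∂μ := by
  have hM' : Measurable M := hM.mono hm le_rfl
  set F : (Fin N → ℝ) → Ω → ℝ≥0∞ := fun y ω =>
    ENNReal.ofReal (Real.exp (∑ i, y i * η i ω - R ^ 2 * (∑ i, y i ^ 2) / 2)) with hF
  have hFmeas : ∀ y, Measurable (F y) := fun y => by simp only [hF]; fun_prop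
  -- deterministic directions
  have hdet : ∀ (y : Fin N → ℝ) (M : Ω → ℝ≥0∞), Measurable[m] M →
      ∫⁻ ω, M ω * F y ω ∂μ ≤ ∫⁻ ω, M ω ∂μ := by
    intro y M hM
    set K := R ^ 2 * (∑ i, y i ^ 2) / 2
    have h1 := lintegral_mul_le_of_condExp_le hm (hint y) (fun ω => (Real.exp_pos _).le)
      measurable_const (hsub y) (hM.mul_const (ENNReal.ofReal (Real.exp (-K))))
    have h2 : ∀ ω, M ω * ENNReal.ofReal (Real.exp (-K)) *
        ENNReal.ofReal (Real.exp (∑ i, y i * η i ω)) = M ω * F y ω := by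
      intro ω
      rw [mul_assoc, ← ENNReal.ofReal_mul (Real.exp_pos _).le, ← Real.exp_add, neg_add_eq_sub]
    have h3 : ∀ ω, M ω * ENNReal.ofReal (Real.exp (-K)) * ENNReal.ofReal (Real.exp K) = M ω := by
      intro ω
      rw [mul_assoc, ← ENNReal.ofReal_mul (Real.exp_pos _).le, ← Real.exp_add]; simp
    simp only [h2] at h1
    exact h1.trans_eq (lintegral_congr h3)
  -- directions with finitely many values
  have hsimple : ∀ f : Ω → Fin N → ℝ, Measurable[m] f → (Set.range f).Finite →
      ∫⁻ ω, M ω * F (f ω) ω ∂μ ≤ ∫⁻ ω, M ω ∂μ := by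
    intro f hf hfin
    have hind : ∀ y, Measurable[m] ((f ⁻¹' {y}).indicator M) := fun y =>
      hM.indicator (hf (measurableSet_singleton y))
    have hsum : ∀ (ω : Ω) (G : (Fin N → ℝ) → ℝ≥0∞), M ω * G (f ω) =
        ∑ y ∈ hfin.toFinset, (f ⁻¹' {y}).indicator M ω * G y := by
      intro ω G
      rw [Finset.sum_eq_single (f ω)]
      · simp
      · intro y _ hy
        rw [Set.indicator_of_notMem, zero_mul]
        simpa using hy.symm
      · intro h
        exact absurd (by simp) h
    calc ∫⁻ ω, M ω * F (f ω) ω ∂μ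
        = ∑ y ∈ hfin.toFinset, ∫⁻ ω, (f ⁻¹' {y}).indicator M ω * F y ω ∂μ := by
          rw [← lintegral_finsetSum]
          · exact lintegral_congr fun ω => hsum ω fun y => F y ω
          · exact fun y _ => ((hind y).mono hm le_rfl).mul (hFmeas y)
      _ ≤ ∑ y ∈ hfin.toFinset, ∫⁻ ω, (f ⁻¹' {y}).indicator M ω ∂μ :=
          Finset.sum_le_sum fun y _ => hdet y _ (hind y)
      _ = ∫⁻ ω, M ω ∂μ := by
          rw [← lintegral_finsetSum]
          · refine lintegral_congr fun ω => ?_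
            simpa using (hsum ω fun _ => 1).symm
          · exact fun y _ => (hind y).mono hm le_rfl
  -- general directions, by approximation and Fatou's lemma
  obtain ⟨f, hf, hfin, hlimf⟩ := @exists_finite_range_tendsto Ω m N c hc
  have hlim : ∀ ω, Filter.Tendsto (fun n => M ω * F (f n ω) ω) Filter.atTop
      (nhds (M ω * F (c ω) ω)) := by
    intro ω
    refine ENNReal.Tendsto.const_mul ?_ (Or.inl (by simp [hF, Real.exp_pos]))
    have hcont : Continuous fun y => F y ω := by
      simp only [hF]
      exact ENNReal.continuous_ofReal.comp (by fun_prop)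
    exact (hcont.tendsto _).comp (hlimf ω)
  calc ∫⁻ ω, M ω * F (c ω) ω ∂μ
      = ∫⁻ ω, Filter.liminf (fun n => M ω * F (f n ω) ω) Filter.atTop ∂μ :=
        lintegral_congr fun ω => (hlim ω).liminf_eq.symm
    _ ≤ Filter.liminf (fun n => ∫⁻ ω, M ω * F (f n ω) ω ∂μ) Filter.atTop := by
        refine lintegral_liminf_le fun n => hM'.mul ?_
        have := (hf n).mono hm le_rfl
        simp only [hF]
        fun_prop
    _ ≤ ∫⁻ ω, M ω ∂μ :=
        Filter.liminf_le_of_le (by isBoundedDefault) fun b hb => by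
          obtain ⟨n, hn⟩ := hb.exists
          exact hn.trans (hsimple _ (hf n) (hfin n))

end CondExp

/-! ### The Gaussian mixture -/

variable {d : ℕ}

/-- Completing the square. -/
lemma exists_shift {V : Matrix (Fin d) (Fin d) ℝ} (hV : V.PosDef) {ρ : ℝ} (hρ : 0 < ρ)
    (s : Vec d) : ∃ u₀ : Vec d, ∀ u, inner ℝ (u + u₀) s - ρ / 2 * wnorm V (u + u₀) ^ 2 =
      wnorm V⁻¹ s ^ 2 / (2 * ρ) - ρ / 2 * wnorm V u ^ 2 := by
  obtain ⟨B, A, -, hBA, h1, h2, h3⟩ := exists_factor hV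
  refine ⟨ρ⁻¹ • A (A s), fun u => ?_⟩
  rw [h1, h1, h2, h3, map_add, map_smul, hBA, norm_add_sq_real, inner_add_left,
    real_inner_smul_left, real_inner_smul_right, norm_smul, real_inner_self_eq_norm_sq,
    Real.norm_eq_abs, abs_of_pos (inv_pos.2 hρ)]
  field_simp
  ring

/-- The Gaussian integral. -/
lemma lintegral_exp_neg_mul_norm_sq {b : ℝ} (hb : 0 < b) :
    ∫⁻ u : Vec d, ENNReal.ofReal (Real.exp (-b * ‖u‖ ^ 2)) =
      ENNReal.ofReal ((Real.pi / b) ^ ((d : ℝ) / 2)) := by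
  have h := GaussianFourier.integral_rexp_neg_mul_sq_norm (V := Vec d) hb
  rw [finrank_euclideanSpace_fin] at h
  have hi : Integrable fun u : Vec d => Real.exp (-b * ‖u‖ ^ 2) := by
    refine Integrable.of_integral_ne_zero ?_
    rw [h]
    have := Real.pi_pos
    positivity
  rw [← h, ofReal_integral_eq_lintegral_ofReal hi (ae_of_all _ fun u => (Real.exp_pos _).le)]

/-- A quadratic form `V ≤ a` has a Gaussian integral at least that of `a`; here the integrand is
moreover tilted by `s`, which contributes the exponential of the dual form at `s`. -/
lemma exp_mul_le_lintegral_exp {V : Matrix (Fin d) (Fin d) ℝ} (hV : V.PosDef) {ρ a : ℝ}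
    (hρ : 0 < ρ) (ha : 0 < a) (hVa : ∀ u : Vec d, wnorm V u ^ 2 ≤ a * ‖u‖ ^ 2) (s : Vec d) :
    ENNReal.ofReal (Real.exp (wnorm V⁻¹ s ^ 2 / (2 * ρ))) *
      ENNReal.ofReal ((Real.pi / (ρ / 2 * a)) ^ ((d : ℝ) / 2)) ≤
    ∫⁻ u : Vec d, ENNReal.ofReal (Real.exp (inner ℝ u s - ρ / 2 * wnorm V u ^ 2)) := by
  obtain ⟨u₀, hu⟩ := exists_shift hV hρ s
  rw [← lintegral_exp_neg_mul_norm_sq (by positivity), ← lintegral_const_mul' _ _ (by simp),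
    ← lintegral_add_right_eq_self
      (fun u => ENNReal.ofReal (Real.exp (inner ℝ u s - ρ / 2 * wnorm V u ^ 2))) u₀]
  refine lintegral_mono fun u => ?_
  rw [← ENNReal.ofReal_mul (Real.exp_pos _).le, ← Real.exp_add, hu]
  refine ENNReal.ofReal_le_ofReal (Real.exp_le_exp.2 ?_)
  nlinarith [hVa u]

namespace Run

variable {Ω : Type*} {N : ℕ}

lemma measurable_feature_history (P : Run Ω d N) {s t : ℕ} (hs : s ∈ Finset.Icc 1 t) (i : Fin N) :
    Measurable[P.history t] (P.feature s i) := by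
  rw [measurable_iff_comap_le]
  exact le_trans (le_trans (le_iSup (fun i => MeasurableSpace.comap (P.feature s i) _) i)
      le_sup_left)
    (le_trans (le_iSup₂ (f := fun s (_ : s ∈ Finset.Icc 1 t) =>
      ((⨆ i, MeasurableSpace.comap (P.feature s i) inferInstance) ⊔
      MeasurableSpace.comap (P.play s) inferInstance)) s hs) le_sup_left)

lemma measurable_play_history (P : Run Ω d N) {s t : ℕ} (hs : s ∈ Finset.Icc 1 t) :
    Measurable[P.history t] (P.play s) := by
  rw [measurable_iff_comap_le]
  exact le_trans le_sup_right
    (le_trans (le_iSup₂ (f := fun s (_ : s ∈ Finset.Icc 1 t) =>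
      ((⨆ i, MeasurableSpace.comap (P.feature s i) inferInstance) ⊔
      MeasurableSpace.comap (P.play s) inferInstance)) s hs) le_sup_left)

lemma observed_history (P : Run Ω d N) (n : ℕ) :
    @Observed d Ω N (P.history (n + 1)) P n := by
  refine @Observed.mk _ _ _ (P.history (n + 1)) _ _ (fun s hs => ?_) (fun s hs => ?_)
    fun s hs i => ?_
  · exact P.measurable_feature_history (Finset.Icc_subset_Icc_right (by omega) hs)
  · exact P.measurable_play_history (Finset.Icc_subset_Icc_right (by omega) hs)
  · rw [measurable_iff_comap_le]
    exact le_trans (le_iSup (fun i => MeasurableSpace.comap (P.seen s i) _) i)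
      (le_trans (le_iSup₂ (f := fun s (_ : s ∈ Finset.Icc 1 (n + 1 - 1)) =>
        ⨆ i, MeasurableSpace.comap (P.seen s i) inferInstance) s hs) le_sup_right)

lemma measurable_feature_info (P : Run Ω d N) {s t : ℕ} (hs : s ∈ Finset.Icc 1 t) (i : Fin N) :
    Measurable[P.info t] (P.feature s i) := by
  rw [measurable_iff_comap_le]
  exact le_trans (le_trans (le_iSup (fun i => MeasurableSpace.comap (P.feature s i) _) i)
      le_sup_left)
    (le_trans (le_iSup₂ (f := fun s (_ : s ∈ Finset.Icc 1 t) =>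
      ((⨆ i, MeasurableSpace.comap (P.feature s i) inferInstance) ⊔
      MeasurableSpace.comap (P.avail s) inferInstance)) s hs) le_sup_left)

lemma measurable_avail_info (P : Run Ω d N) {s t : ℕ} (hs : s ∈ Finset.Icc 1 t) :
    Measurable[P.info t] (P.avail s) := by
  rw [measurable_iff_comap_le]
  exact le_trans le_sup_right
    (le_trans (le_iSup₂ (f := fun s (_ : s ∈ Finset.Icc 1 t) =>
      ((⨆ i, MeasurableSpace.comap (P.feature s i) inferInstance) ⊔
      MeasurableSpace.comap (P.avail s) inferInstance)) s hs) le_sup_left)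

lemma observed_info (P : Run Ω d N) (n : ℕ) :
    @Observed d Ω N (P.info (n + 1)) P n := by
  have key : ∀ s ∈ Finset.Icc 1 n, MeasurableSpace.comap (P.play s) inferInstance ⊔
      (⨆ i, MeasurableSpace.comap (P.seen s i) inferInstance) ≤ P.info (n + 1) := fun s hs =>
    le_trans (le_iSup₂ (f := fun s (_ : s ∈ Finset.Icc 1 (n + 1 - 1)) =>
      MeasurableSpace.comap (P.play s) inferInstance ⊔
      ⨆ i, MeasurableSpace.comap (P.seen s i) inferInstance) s hs) le_sup_right
  refine @Observed.mk _ _ _ (P.info (n + 1)) _ _ (fun s hs => ?_) (fun s hs => ?_)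
    fun s hs i => ?_
  · exact P.measurable_feature_info (Finset.Icc_subset_Icc_right (by omega) hs)
  · rw [measurable_iff_comap_le]
    exact le_trans le_sup_left (key s hs)
  · rw [measurable_iff_comap_le]
    exact le_trans (le_trans (le_iSup (fun i => MeasurableSpace.comap (P.seen s i) _) i)
      le_sup_right) (key s hs)

lemma info_mono (P : Run Ω d N) {s t : ℕ} (h : s ≤ t) : P.info s ≤ P.info t :=
  sup_le_sup (biSup_mono fun _ hr => Finset.Icc_subset_Icc_right h hr)
    (biSup_mono fun _ hr => Finset.Icc_subset_Icc_right (by omega) hr)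

end Run

end

section

/-! ### Concentration of the estimator -/

section Measurability

variable {Ω : Type*} [MeasurableSpace Ω] {d N : ℕ} {P : Run Ω d N}

lemma measurable_inner_const (u : Vec d) {x : Ω → Vec d} (hx : Measurable x) :
    Measurable fun ω => (inner ℝ u (x ω) : ℝ) :=
  measurable_const.inner hx

lemma measurable_direction {t : ℕ} (hp : Measurable (P.play t))
    (hf : ∀ i, Measurable (P.feature t i)) (u : Vec d) :
    Measurable fun ω (i : Fin N) =>
      if i ∈ P.play t ω then (inner ℝ u (P.feature t i ω) : ℝ) else 0 :=
  measurable_pi_lambda _ fun i => Measurable.ite (Run.measurableSet_mem_play hp i)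
    (measurable_inner_const u (hf i)) measurable_const

lemma Run.Observed.measurable_exp_noiseSum {n : ℕ} (h : P.Observed n) (θ u : Vec d) (a : ℝ) :
    Measurable fun ω => ENNReal.ofReal (Real.exp (inner ℝ u (P.noiseSum θ n ω) - a *
      ∑ s ∈ Finset.Icc 1 n, ∑ i ∈ P.play s ω, inner ℝ u (P.feature s i ω) ^ 2)) := by
  have h2 : Measurable fun ω =>
      ∑ s ∈ Finset.Icc 1 n, ∑ i ∈ P.play s ω, (inner ℝ u (P.feature s i ω) : ℝ) ^ 2 :=
    Finset.measurable_sum _ fun s hs => Run.measurable_sum_mem (h.play s hs) fun i =>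
      (measurable_inner_const u (h.feature s hs i)).pow_const 2
  exact ((measurable_inner_const u (h.measurable_noiseSum θ)).sub
    (h2.const_mul _)).exp.ennreal_ofReal

end Measurability

variable {Ω : Type*} [m0 : MeasurableSpace Ω] {μ : Measure Ω} {d N : ℕ} {P : Run Ω d N}
  {k T : ℕ} {R S lam : ℝ} {θ : Vec d} {v : ℕ → ℝ}

lemma measurable_seen (hE : IsEnvironment μ P k T R S θ) (hA : IsRoundwiseTS μ P T lam v)
    {s : ℕ} (hs : s ∈ Finset.Icc 1 T) (i : Fin N) : Measurable (P.seen s i) :=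
  Measurable.ite (Run.measurableSet_mem_play (hA.measurable_play s hs) i)
    (hE.measurable_reward s hs i) measurable_const

lemma history_le (hE : IsEnvironment μ P k T R S θ) (hA : IsRoundwiseTS μ P T lam v)
    {t : ℕ} (ht : t ≤ T) : P.history t ≤ m0 := by
  have hsub : ∀ s ∈ Finset.Icc 1 t, s ∈ Finset.Icc 1 T := fun s hs =>
    Finset.Icc_subset_Icc_right ht hs
  have hsub' : ∀ s ∈ Finset.Icc 1 (t - 1), s ∈ Finset.Icc 1 T := fun s hs =>
    Finset.Icc_subset_Icc_right (by omega) hs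
  refine sup_le (iSup₂_le fun s hs => sup_le (iSup_le fun i => ?_) ?_)
    (iSup₂_le fun s hs => iSup_le fun i => ?_)
  · exact (hE.measurable_feature s (hsub s hs) i).comap_le
  · exact (hA.measurable_play s (hsub s hs)).comap_le
  · exact (measurable_seen hE hA (hsub' s hs) i).comap_le

lemma info_le (hE : IsEnvironment μ P k T R S θ) (hA : IsRoundwiseTS μ P T lam v)
    {t : ℕ} (ht : t ≤ T) : P.info t ≤ m0 := by
  have hsub : ∀ s ∈ Finset.Icc 1 t, s ∈ Finset.Icc 1 T := fun s hs =>
    Finset.Icc_subset_Icc_right ht hs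
  have hsub' : ∀ s ∈ Finset.Icc 1 (t - 1), s ∈ Finset.Icc 1 T := fun s hs =>
    Finset.Icc_subset_Icc_right (by omega) hs
  refine sup_le (iSup₂_le fun s hs => sup_le (iSup_le fun i => ?_) ?_)
    (iSup₂_le fun s hs => sup_le ?_ (iSup_le fun i => ?_))
  · exact (hE.measurable_feature s (hsub s hs) i).comap_le
  · exact (hE.measurable_avail s (hsub s hs)).comap_le
  · exact (hA.measurable_play s (hsub' s hs)).comap_le
  · exact (measurable_seen hE hA (hsub' s hs) i).comap_le

lemma observed (hE : IsEnvironment μ P k T R S θ) (hA : IsRoundwiseTS μ P T lam v) :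
    P.Observed T :=
  ⟨hE.measurable_feature, hA.measurable_play, fun _ hs => measurable_seen hE hA hs⟩

lemma bounded (hE : IsEnvironment μ P k T R S θ) (hA : IsRoundwiseTS μ P T lam v) (ω : Ω) :
    P.Bounded k T ω :=
  fun s hs => ⟨hE.card_le s hs ω _ (hA.play_argmax s hs ω).1, fun i => hE.norm_feature_le s hs i ω⟩

/-- The exponential supermartingale of the noise in a fixed direction `u`. -/
lemma lintegral_exp_noiseSum_le [IsProbabilityMeasure μ] (hE : IsEnvironment μ P k T R S θ)
    (hA : IsRoundwiseTS μ P T lam v) (u : Vec d) {n : ℕ} (hn : n ≤ T) :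
    ∫⁻ ω, ENNReal.ofReal (Real.exp (inner ℝ u (P.noiseSum θ n ω) - R ^ 2 / 2 *
      ∑ s ∈ Finset.Icc 1 n, ∑ i ∈ P.play s ω, inner ℝ u (P.feature s i ω) ^ 2)) ∂μ ≤ 1 := by
  classical
  induction n with
  | zero => simp [Run.noiseSum]
  | succ n ih =>
    have hm := history_le hE hA hn
    have hT : n + 1 ∈ Finset.Icc 1 T := Finset.mem_Icc.2 ⟨by omega, hn⟩
    have h1 : n + 1 ∈ Finset.Icc 1 (n + 1) := by simp
    refine le_trans ?_ (ih (by omega))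
    have hO := P.observed_history n
    set c : Ω → Fin N → ℝ := fun ω i =>
      if i ∈ P.play (n + 1) ω then inner ℝ u (P.feature (n + 1) i ω) else 0 with hc
    have hcm : Measurable[P.history (n + 1)] c :=
      @measurable_direction Ω (P.history (n + 1)) d N P _ (P.measurable_play_history h1)
        (P.measurable_feature_history h1) u
    have hM := @Run.Observed.measurable_exp_noiseSum Ω (P.history (n + 1)) d N P n hO θ u
      (R ^ 2 / 2)
    have hη : ∀ i, Measurable (P.noise θ (n + 1) i) := fun i =>
      (hE.measurable_reward _ hT i).sub (measurable_const.inner (hE.measurable_feature _ hT i))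
    have key := lintegral_mul_exp_le_of_subGaussian hm (hE.integrable_exp_noise _ hT) hη
      (hE.subGaussian_noise _ hT) hcm hM
    refine le_trans (le_of_eq (lintegral_congr fun ω => ?_)) key
    rw [← ENNReal.ofReal_mul (Real.exp_pos _).le, ← Real.exp_add]
    congr 2
    have h2 : P.noiseSum θ (n + 1) ω = P.noiseSum θ n ω +
        ∑ i ∈ P.play (n + 1) ω, P.noise θ (n + 1) i ω • P.feature (n + 1) i ω := by
      rw [Run.noiseSum, Finset.sum_Icc_succ_top (by omega)]; rfl
    have h3 : ∑ i, c ω i * P.noise θ (n + 1) i ω = ∑ i ∈ P.play (n + 1) ω,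
        P.noise θ (n + 1) i ω * inner ℝ u (P.feature (n + 1) i ω) := by
      simp only [hc, ite_mul, zero_mul, ← Finset.sum_filter]
      simp [mul_comm]
    have h4 : ∑ i, c ω i ^ 2 =
        ∑ i ∈ P.play (n + 1) ω, inner ℝ u (P.feature (n + 1) i ω) ^ 2 := by
      simp only [hc, ite_pow, zero_pow two_ne_zero, ← Finset.sum_filter]
      simp
    rw [h2, inner_add_right, inner_sum, h3, h4, Finset.sum_Icc_succ_top (by omega)]
    simp only [real_inner_smul_right]
    ring

/-- The method of mixtures: the exponential supermartingales of all directions `u`, mixed over a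
centred Gaussian `u` of precision `ρ lam`. The bound `V_n ≤ lam + k n` replaces the determinant
of `V_n`. Only `ρ ≥ R²` is needed, which leaves room to treat `R = 0`. -/
lemma lintegral_exp_wnorm_noiseSum_le [IsProbabilityMeasure μ]
    (hE : IsEnvironment μ P k T R S θ) (hA : IsRoundwiseTS μ P T lam v) (hlam : 0 < lam)
    {ρ : ℝ} (hρ : 0 < ρ) (hR : R ^ 2 ≤ ρ) {n : ℕ} (hn : n ≤ T) :
    ∫⁻ ω, ENNReal.ofReal (Real.exp
      (wnorm (P.V lam n ω)⁻¹ (P.noiseSum θ n ω) ^ 2 / (2 * ρ))) ∂μ ≤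
      ENNReal.ofReal ((1 + k * n / lam) ^ ((d : ℝ) / 2)) := by
  set a : ℝ := lam + k * n with ha
  have ha0 : 0 < a := by positivity
  have hO := (observed hE hA).mono hn
  have hS := hO.measurable_noiseSum θ
  set F : Vec d → Ω → ℝ≥0∞ := fun u ω => ENNReal.ofReal (Real.exp
    (inner ℝ u (P.noiseSum θ n ω) - ρ / 2 * wnorm (P.V lam n ω) u ^ 2)) with hF
  have hFm : Measurable (Function.uncurry F) := by
    have h1 : Measurable fun p : Vec d × Ω => wnorm (P.V lam n p.2) p.1 :=
      Run.measurable_wnorm (fun i j => (hO.measurable_V lam i j).comp measurable_snd)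
        measurable_fst
    have h2 : Measurable fun p : Vec d × Ω => (inner ℝ p.1 (P.noiseSum θ n p.2) : ℝ) :=
      measurable_fst.inner (hS.comp measurable_snd)
    exact (h2.sub ((h1.pow_const 2).const_mul _)).exp.ennreal_ofReal
  have hswap : ∫⁻ ω, ∫⁻ u, F u ω ∂volume ∂μ = ∫⁻ u, ∫⁻ ω, F u ω ∂μ ∂volume :=
    (lintegral_lintegral_swap (μ := (volume : Measure (Vec d))) (ν := μ) hFm.aemeasurable).symm
  have hup : ∫⁻ u, ∫⁻ ω, F u ω ∂μ ∂volume ≤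
      ENNReal.ofReal ((Real.pi / (ρ / 2 * lam)) ^ ((d : ℝ) / 2)) := by
    rw [← lintegral_exp_neg_mul_norm_sq (by positivity)]
    refine lintegral_mono fun u => ?_
    calc ∫⁻ ω, F u ω ∂μ ≤ ∫⁻ ω, ENNReal.ofReal (Real.exp (-(ρ / 2 * lam) * ‖u‖ ^ 2)) *
          ENNReal.ofReal (Real.exp (inner ℝ u (P.noiseSum θ n ω) - R ^ 2 / 2 *
          ∑ s ∈ Finset.Icc 1 n, ∑ i ∈ P.play s ω, inner ℝ u (P.feature s i ω) ^ 2)) ∂μ := by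
          refine lintegral_mono fun ω => ?_
          rw [← ENNReal.ofReal_mul (Real.exp_pos _).le, ← Real.exp_add]
          refine ENNReal.ofReal_le_ofReal (Real.exp_le_exp.2 ?_)
          rw [P.wnorm_V_sq hlam]
          have h0 : 0 ≤ ∑ s ∈ Finset.Icc 1 n, ∑ i ∈ P.play s ω,
              inner ℝ u (P.feature s i ω) ^ 2 :=
            Finset.sum_nonneg fun _ _ => Finset.sum_nonneg fun _ _ => sq_nonneg _
          nlinarith
      _ ≤ ENNReal.ofReal (Real.exp (-(ρ / 2 * lam) * ‖u‖ ^ 2)) := by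
          rw [lintegral_const_mul' _ _ (by simp)]
          exact mul_le_of_le_one_right' (lintegral_exp_noiseSum_le hE hA u hn)
  have hlow : (∫⁻ ω, ENNReal.ofReal (Real.exp
      (wnorm (P.V lam n ω)⁻¹ (P.noiseSum θ n ω) ^ 2 / (2 * ρ))) ∂μ) *
      ENNReal.ofReal ((Real.pi / (ρ / 2 * a)) ^ ((d : ℝ) / 2)) ≤ ∫⁻ ω, ∫⁻ u, F u ω ∂volume ∂μ := by
    rw [← lintegral_mul_const' _ _ (by simp)]
    exact lintegral_mono fun ω => exp_mul_le_lintegral_exp (P.V_posDef hlam n ω) hρ ha0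
      (Run.wnorm_V_sq_le ((bounded hE hA ω).mono hn) hlam) _
  have hpi := Real.pi_pos
  have hratio : (Real.pi / (ρ / 2 * lam)) ^ ((d : ℝ) / 2) =
      (1 + k * n / lam) ^ ((d : ℝ) / 2) * (Real.pi / (ρ / 2 * a)) ^ ((d : ℝ) / 2) := by
    rw [← Real.mul_rpow (by positivity) (by positivity)]
    congr 1
    rw [ha]; field_simp
  have h := hlow.trans (hswap.le.trans hup)
  rw [hratio, ENNReal.ofReal_mul (by positivity)] at h
  refine (ENNReal.mul_le_mul_iff_left ?_ (by simp)).1 h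
  have : 0 < (Real.pi / (ρ / 2 * a)) ^ ((d : ℝ) / 2) := by positivity
  simpa using this

/-- Markov's inequality for the mixture. The level only involves some `r ≥ R`, `r > 0`, and the
factor `√2` absorbs the constants of the exponential bound; the exact form
`√(d log X + 2 log (1 / δ))` of the level is bounded by `√(2 d log (X / δ))`. -/
lemma measure_lt_wnorm_noiseSum_le [IsProbabilityMeasure μ]
    (hE : IsEnvironment μ P k T R S θ) (hA : IsRoundwiseTS μ P T lam v) (hlam : 0 < lam)
    (hd : 1 ≤ d) {r : ℝ} (hr : 0 < r) (hR0 : 0 ≤ R) (hR : R ≤ r) {n : ℕ} (hn : n ≤ T) {δ : ℝ}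
    (hδ : 0 < δ) (hδ1 : δ < 1) :
    μ {ω | √2 * (r * √(d * Real.log ((1 + k * n / lam) / δ))) <
      wnorm (P.V lam n ω)⁻¹ (P.noiseSum θ n ω)} ≤ ENNReal.ofReal δ := by
  have hx1 : (1 : ℝ) ≤ 1 + k * n / lam := le_add_of_nonneg_right (by positivity)
  set X : ℝ := 1 + k * n / lam
  have hX0 : 0 < X := by linarith
  have hd' : (1 : ℝ) ≤ d := by exact_mod_cast hd
  have hlX : 0 ≤ Real.log X := Real.log_nonneg hx1
  have hlδ : 0 ≤ -Real.log δ := by linarith [Real.log_neg hδ hδ1]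
  have h1 := lintegral_exp_wnorm_noiseSum_le hE hA hlam (ρ := r ^ 2) (by positivity)
    (pow_le_pow_left₀ hR0 hR 2) hn
  have hincl : {ω | √2 * (r * √(d * Real.log (X / δ))) <
      wnorm (P.V lam n ω)⁻¹ (P.noiseSum θ n ω)} ⊆
      {ω | ENNReal.ofReal (X ^ ((d : ℝ) / 2) / δ) ≤ ENNReal.ofReal (Real.exp
      (wnorm (P.V lam n ω)⁻¹ (P.noiseSum θ n ω) ^ 2 / (2 * r ^ 2)))} := by
    intro ω hω
    simp only [Set.mem_ofPred_eq] at hω ⊢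
    refine ENNReal.ofReal_le_ofReal ?_
    rw [← Real.exp_log (show 0 < X ^ ((d : ℝ) / 2) / δ by positivity)]
    refine Real.exp_le_exp.2 ?_
    rw [Real.log_div (by positivity) hδ.ne', Real.log_rpow hX0, le_div_iff₀ (by positivity)]
    have h2 := pow_le_pow_left₀ (by positivity) hω.le 2
    rw [Real.log_div hX0.ne' hδ.ne', mul_pow, mul_pow, Real.sq_sqrt (by norm_num),
      Real.sq_sqrt (by nlinarith)] at h2
    refine le_trans ?_ h2
    have h3 : (d : ℝ) / 2 * Real.log X - Real.log δ ≤ d * (Real.log X - Real.log δ) := by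
      nlinarith
    nlinarith [sq_nonneg r]
  have hOn := (observed hE hA).mono hn
  have hmeas : Measurable fun ω => ENNReal.ofReal (Real.exp
      (wnorm (P.V lam n ω)⁻¹ (P.noiseSum θ n ω) ^ 2 / (2 * r ^ 2))) :=
    (((Run.measurable_wnorm (hOn.measurable_V_inv lam)
      (hOn.measurable_noiseSum θ)).pow_const 2).div_const _).exp.ennreal_ofReal
  have h2 := mul_meas_ge_le_lintegral (μ := μ) hmeas (ENNReal.ofReal (X ^ ((d : ℝ) / 2) / δ))
  have h3 := h2.trans h1
  have hne : ENNReal.ofReal (X ^ ((d : ℝ) / 2) / δ) ≠ 0 := by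
    have : 0 < X ^ ((d : ℝ) / 2) / δ := by positivity
    simpa using this
  have h4 : ENNReal.ofReal (X ^ ((d : ℝ) / 2)) =
      ENNReal.ofReal (X ^ ((d : ℝ) / 2) / δ) * ENNReal.ofReal δ := by
    rw [← ENNReal.ofReal_mul (by positivity), div_mul_cancel₀ _ hδ.ne']
  rw [h4] at h3
  exact (measure_mono hincl).trans ((ENNReal.mul_le_mul_iff_right hne (by simp)).1 h3)

end

section

/-! ### Conditional laws -/

section Freezing

variable {Ω : Type*} {m m0 : MeasurableSpace Ω} {μ : Measure Ω} [IsProbabilityMeasure μ] {d : ℕ}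

/-- Freezing: if the conditional law of `Y` given `m` is `G`, then in conditional expectations of
`f (ω, Y ω)` the `m`-measurable argument may be treated as a constant. -/
lemma condExp_eq_integral_of_condLaw (hm : m ≤ m0) {Y : Ω → Vec d} (hY : Measurable Y)
    {G : Ω → Measure (Vec d)} (hG : ∀ ω, IsProbabilityMeasure (G ω))
    (hlaw : ∀ B : Set (Vec d), MeasurableSet B → μ⟦Y ⁻¹' B | m⟧ =ᵐ[μ] fun ω => (G ω).real B)
    {f : Ω × Vec d → ℝ} (hf : Measurable[m.prod (inferInstance : MeasurableSpace (Vec d))] f)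
    (hint : Integrable (fun ω => f (ω, Y ω)) μ) :
    μ[fun ω => f (ω, Y ω) | m] =ᵐ[μ] fun ω => ∫ y, f (ω, y) ∂(G ω) := by
  have hX : @Measurable Ω Ω m0 m id := measurable_id'' hm
  have hcomap : m.comap id = m := MeasurableSpace.comap_id
  set κ := @condDistrib Ω Ω (Vec d) _ _ _ m0 m Y id μ _ with hκ
  have hprob : ∀ ω, IsProbabilityMeasure (κ ω) := fun ω => inferInstance
  have hfs : StronglyMeasurable[m.prod (inferInstance : MeasurableSpace (Vec d))] f :=
    hf.stronglyMeasurable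
  have h1 := @condExp_prod_ae_eq_integral_condDistrib Ω Ω (Vec d) ℝ _ _ _ _ m0 μ _ id Y m f _ _ hX
    hY.aemeasurable hfs hint
  rw [hcomap] at h1
  -- The regular conditional law of `Y` agrees with `G` on a countable generating algebra.
  have h2 : ∀ᵐ ω ∂μ, κ ω = G ω := by
    set C := generateSetAlgebra (MeasurableSpace.countableGeneratingSet (Vec d)) with hC
    have hCc : C.Countable :=
      countable_generateSetAlgebra MeasurableSpace.countable_countableGeneratingSet
    have hCg : (WithLp.measurableSpace 2 (Fin d → ℝ) : MeasurableSpace (Vec d)) =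
        MeasurableSpace.generateFrom C := by
      rw [hC, generateFrom_generateSetAlgebra_eq,
        MeasurableSpace.generateFrom_countableGeneratingSet]
    have hCm : ∀ B ∈ C, MeasurableSet B := by
      intro B hB
      exact hCg ▸ MeasurableSpace.measurableSet_generateFrom hB
    have h3 : ∀ᵐ ω ∂μ, ∀ B ∈ C, (κ ω).real B = (G ω).real B := by
      rw [ae_ball_iff hCc]
      intro B hB
      have h4 := @condDistrib_ae_eq_condExp Ω Ω (Vec d) _ _ _ m0 μ _ id Y m B hX hY (hCm B hB)
      rw [hcomap] at h4
      filter_upwards [h4, hlaw B (hCm B hB)] with ω h5 h6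
      rw [← h6, ← h5]; rfl
    filter_upwards [h3] with ω hω
    have := hprob ω
    have := hG ω
    refine ext_of_generate_finite C hCg
      (isSetAlgebra_generateSetAlgebra.isSetRing.isSetSemiring.isPiSystem) (fun B hB => ?_)
      (by simp)
    rw [← measureReal_eq_measureReal_iff]; exact hω B hB
  filter_upwards [h1, h2] with ω h3 h4
  exact h3.trans (by rw [← h4]; rfl)

end Freezing

/-! ### The sampling distribution -/

/-- The probability that a standard normal variable is at least `2`. It bounds from below the
probability of an optimistic sample. -/
def optimismProb : ℝ := (gaussianReal 0 1).real (Set.Ici 2)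

lemma optimismProb_pos : 0 < optimismProb := by
  have h : (gaussianReal 0 1) (Set.Ici (2 : ℝ)) ≠ 0 := fun h => by
    have := gaussianReal_absolutelyContinuous' 0 one_ne_zero h
    simp at this
  exact ENNReal.toReal_pos h (by simp)

lemma optimismProb_le_one : optimismProb ≤ 1 := measureReal_le_one

lemma gaussianReal_tail_le {a : ℝ} (ha : 0 ≤ a) :
    (gaussianReal 0 1).real {x | a < |x|} ≤ 2 * Real.exp (-a ^ 2 / 2) := by
  have hone : ∀ ε : ℝ, ε ^ 2 = 1 →
      (gaussianReal 0 1).real {x | a ≤ ε * x} ≤ Real.exp (-a ^ 2 / 2) := by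
    intro ε hε
    have hint : Integrable (fun x : ℝ => Real.exp (a * (ε * x))) (gaussianReal 0 1) := by
      simpa [mul_assoc] using integrable_exp_mul_gaussianReal (μ := 0) (v := 1) (a * ε)
    have h := measure_ge_le_exp_mul_mgf (X := fun x : ℝ => ε * x) a ha hint
    refine h.trans (le_of_eq ?_)
    have h2 : mgf (fun x : ℝ => ε * x) (gaussianReal 0 1) a =
        mgf (fun x => x) (gaussianReal 0 1) (a * ε) := by simp [mgf, mul_assoc]
    rw [h2, mgf_fun_id_gaussianReal, ← Real.exp_add]
    congr 1
    rw [mul_pow, hε]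
    simp; ring
  have hsub : {x : ℝ | a < |x|} ⊆ {x | a ≤ 1 * x} ∪ {x | a ≤ -1 * x} := by
    intro x hx
    rcases lt_abs.1 (show a < |x| from hx) with h | h
    · exact Or.inl (by simpa using h.le)
    · exact Or.inr (by simpa using h.le)
  calc _ ≤ _ := measureReal_mono hsub
    _ ≤ _ := measureReal_union_le _ _
    _ ≤ _ := by linarith [hone 1 (by norm_num), hone (-1) (by norm_num)]

section Sampling

variable {d : ℕ} {V : Matrix (Fin d) (Fin d) ℝ}

/-- In the direction `X`, the centred sampling law is Gaussian with standard deviation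
`v ‖X‖`, the norm being that of `V⁻¹`. -/
lemma map_inner_multivariateGaussian (hV : V.PosDef) (x₀ : Vec d) (v : ℝ) (X : Vec d) :
    (multivariateGaussian x₀ (v ^ 2 • V⁻¹)).map (fun θ => inner ℝ X (θ - x₀)) =
      (gaussianReal 0 1).map (fun z => v * wnorm V⁻¹ X * z) := by
  have hS : (v ^ 2 • V⁻¹).PosSemidef := hV.inv.posSemidef.smul (sq_nonneg v)
  set ν := multivariateGaussian x₀ (v ^ 2 • V⁻¹) with hν
  have h1 : ν.map (innerSL ℝ X) = gaussianReal (inner ℝ X x₀)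
      (.mk ((v * wnorm V⁻¹ X) ^ 2) (sq_nonneg _)) := by
    rw [IsGaussian.map_eq_gaussianReal]
    congr 1
    · rw [ContinuousLinearMap.integral_comp_id_comm IsGaussian.integrable_id,
        integral_id_multivariateGaussian]
      rfl
    · have h2 : Var[innerSL ℝ X; ν] = (v * wnorm V⁻¹ X) ^ 2 := by
        have h3 := covarianceBilin_self (μ := ν) IsGaussian.memLp_two_id X
        rw [covarianceBilin_multivariateGaussian hS] at h3
        rw [mul_pow, wnorm_sq hV.inv.posSemidef]
        refine Eq.trans h3.symm ?_
        rw [smul_mulVec, dotProduct_smul, smul_eq_mul]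
      ext
      rw [h2, Real.coe_toNNReal _ (sq_nonneg _)]; rfl
  have h4 : (fun θ : Vec d => (inner ℝ X (θ - x₀) : ℝ)) =
      (fun y => y - inner ℝ X x₀) ∘ (innerSL ℝ X) := by
    funext θ; simp [inner_sub_right]
  rw [h4, ← Measure.map_map (by fun_prop) (by fun_prop), h1, gaussianReal_map_sub_const,
    gaussianReal_map_const_mul]
  simp

/-- In every direction, the sample exceeds its mean by two standard deviations with probability at
least `optimismProb`; it is exactly that unless the standard deviation vanishes. -/
lemma optimismProb_le (hV : V.PosDef) (x₀ : Vec d) {v : ℝ} (hv : 0 ≤ v) (X : Vec d) :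
    optimismProb ≤ (multivariateGaussian x₀ (v ^ 2 • V⁻¹)).real
      {θ | 2 * v * wnorm V⁻¹ X ≤ inner ℝ X (θ - x₀)} := by
  have h := map_inner_multivariateGaussian hV x₀ v X
  have h1 : (multivariateGaussian x₀ (v ^ 2 • V⁻¹)).real
      {θ | 2 * v * wnorm V⁻¹ X ≤ inner ℝ X (θ - x₀)} =
      ((gaussianReal 0 1).map (fun z => v * wnorm V⁻¹ X * z)).real
        (Set.Ici (2 * v * wnorm V⁻¹ X)) := by
    rw [← h, map_measureReal_apply (by fun_prop) measurableSet_Ici]; rfl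
  rw [h1, map_measureReal_apply (by fun_prop) measurableSet_Ici]
  refine measureReal_mono fun z hz => ?_
  have hz' : 2 ≤ z := hz
  have := mul_nonneg hv (wnorm_nonneg V⁻¹ X)
  change 2 * v * wnorm V⁻¹ X ≤ v * wnorm V⁻¹ X * z
  nlinarith

/-- A union bound over the `d` coordinates in which the sampling law is standard up to the
scale `v`. -/
lemma sampling_tail_le (hV : V.PosDef) (x₀ : Vec d) {v a : ℝ} (hv : 0 ≤ v) (ha : 0 ≤ a) :
    (multivariateGaussian x₀ (v ^ 2 • V⁻¹)).real {θ | v * √d * a < wnorm V (θ - x₀)} ≤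
      d * (2 * Real.exp (-a ^ 2 / 2)) := by
  obtain ⟨B, A, hAB, -, h1, h2, h3⟩ := exists_factor hV
  set e : Fin d → Vec d := fun j => EuclideanSpace.single j 1 with he
  have hw : ∀ j, wnorm V⁻¹ (B (e j)) = 1 := by intro j; rw [h2, hAB]; simp [he]
  have hcoord : ∀ θ j, inner ℝ (B (e j)) (θ - x₀) = (B (θ - x₀)).ofLp j := by
    intro θ j
    rw [real_inner_comm, h3, hAB]
    simp [he, EuclideanSpace.inner_single_right]
  set ν := multivariateGaussian x₀ (v ^ 2 • V⁻¹) with hν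
  have hsub : {θ | v * √d * a < wnorm V (θ - x₀)} ⊆
      ⋃ j ∈ (Finset.univ : Finset (Fin d)), {θ | v * a < |inner ℝ (B (e j)) (θ - x₀)|} := by
    intro θ hθ
    by_contra hcon
    simp only [Finset.mem_univ, Set.iUnion_true, Set.mem_iUnion, Set.mem_ofPred_eq, not_exists,
      not_lt, hcoord] at hcon hθ
    refine absurd hθ (not_lt.2 ?_)
    rw [h1, EuclideanSpace.norm_eq]
    refine Real.sqrt_le_iff.2 ⟨by positivity, ?_⟩
    calc ∑ j, ‖(B (θ - x₀)).ofLp j‖ ^ 2 ≤ ∑ _j : Fin d, (v * a) ^ 2 :=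
          Finset.sum_le_sum fun j _ => pow_le_pow_left₀ (norm_nonneg _) (hcon j) 2
      _ = (v * √d * a) ^ 2 := by
          rw [mul_pow (v * √d), mul_pow v (√d), Real.sq_sqrt (by positivity)]; simp; ring
  calc ν.real {θ | v * √d * a < wnorm V (θ - x₀)}
      ≤ ∑ j : Fin d, ν.real {θ | v * a < |inner ℝ (B (e j)) (θ - x₀)|} :=
        (measureReal_mono hsub (measure_ne_top _ _)).trans (measureReal_biUnion_finset_le _ _)
    _ ≤ ∑ _j : Fin d, 2 * Real.exp (-a ^ 2 / 2) := by
        refine Finset.sum_le_sum fun j _ => le_trans ?_ (gaussianReal_tail_le ha)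
        have hmeas : MeasurableSet {y : ℝ | v * a < |y|} :=
          measurableSet_lt measurable_const (by fun_prop)
        have h4 : ν.real {θ | v * a < |inner ℝ (B (e j)) (θ - x₀)|} =
            ((gaussianReal 0 1).map (fun z => v * wnorm V⁻¹ (B (e j)) * z)).real
              {y | v * a < |y|} := by
          rw [← map_inner_multivariateGaussian hV x₀ v, map_measureReal_apply (by fun_prop) hmeas]
          rfl
        rw [h4, map_measureReal_apply (by fun_prop) hmeas, hw]
        refine measureReal_mono fun z hz => ?_
        simp only [Set.mem_preimage, Set.mem_ofPred_eq, mul_one, abs_mul, abs_of_nonneg hv] at hz ⊢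
        exact lt_of_mul_lt_mul_left hz hv
    _ = d * (2 * Real.exp (-a ^ 2 / 2)) := by simp

end Sampling

end

section

/-! ### Optimism -/

variable {d N : ℕ}

open Classical in
/-- The smallest width `√(X_Jᵀ W X_J)`, where `X_J = ∑_{i ∈ J} x i`, among the super arms `J` that
are optimal for the parameter `θ`. The minimum removes the dependence on the breaking of ties.
Super arms that are not optimal count with the value `B`, meant to exceed all widths. -/
def argmaxWidth (W : Matrix (Fin d) (Fin d) ℝ) (A : Finset (Finset (Fin N))) (x : Fin N → Vec d)
    (B : ℝ) (θ : Vec d) : ℝ :=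
  ⨅ J : Finset (Fin N),
    if IsArgmax A (fun i => inner ℝ θ (x i)) J then wnorm W (∑ i ∈ J, x i) else B

section ArgmaxWidth

variable {W : Matrix (Fin d) (Fin d) ℝ} {A : Finset (Finset (Fin N))} {x : Fin N → Vec d}
  {B : ℝ} {θ : Vec d}

lemma argmaxWidth_nonneg (hB : 0 ≤ B) : 0 ≤ argmaxWidth W A x B θ :=
  le_ciInf fun J => by split_ifs; exacts [wnorm_nonneg _ _, hB]

lemma argmaxWidth_le {J : Finset (Fin N)} (hJ : IsArgmax A (fun i => inner ℝ θ (x i)) J) :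
    argmaxWidth W A x B θ ≤ wnorm W (∑ i ∈ J, x i) := by
  refine (ciInf_le (Set.finite_range _).bddBelow J).trans ?_
  rw [if_pos hJ]

lemma le_argmaxWidth {b : ℝ} (hb : b ≤ B)
    (h : ∀ J, IsArgmax A (fun i => inner ℝ θ (x i)) J → b ≤ wnorm W (∑ i ∈ J, x i)) :
    b ≤ argmaxWidth W A x B θ :=
  le_ciInf fun J => by split_ifs with hJ; exacts [h J hJ, hb]

lemma exists_isArgmax (hA : A.Nonempty) (w : Fin N → ℝ) : ∃ J, IsArgmax A w J :=
  (A.exists_max_image (fun J => ∑ i ∈ J, w i) hA).imp fun _ h => ⟨h.1, h.2⟩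

lemma measurable_argmaxWidth {Ω : Type*} [MeasurableSpace Ω]
    {W : Ω → Matrix (Fin d) (Fin d) ℝ} (hW : ∀ i j, Measurable fun ω => W ω i j)
    {A : Ω → Finset (Finset (Fin N))} (hA : Measurable A) {x : Fin N → Ω → Vec d}
    (hx : ∀ i, Measurable (x i)) {θ : Ω → Vec d} (hθ : Measurable θ) (B : ℝ) :
    Measurable fun ω => argmaxWidth (W ω) (A ω) (fun i => x i ω) B (θ ω) := by
  classical
  have hmem : ∀ K, MeasurableSet {ω | K ∈ A ω} := fun K => hA (measurableSet_mem_finset K)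
  have hs : ∀ K : Finset (Fin N), Measurable fun ω => ∑ i ∈ K, (inner ℝ (θ ω) (x i ω) : ℝ) :=
    fun K => Finset.measurable_sum _ fun i _ => hθ.inner (hx i)
  have hset : ∀ J, MeasurableSet {ω | IsArgmax (A ω) (fun i => inner ℝ (θ ω) (x i ω)) J} := by
    intro J
    have : {ω | IsArgmax (A ω) (fun i => inner ℝ (θ ω) (x i ω)) J} = {ω | J ∈ A ω} ∩
        ⋂ K, ({ω | K ∈ A ω}ᶜ ∪ {ω | ∑ i ∈ K, (inner ℝ (θ ω) (x i ω) : ℝ) ≤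
          ∑ i ∈ J, (inner ℝ (θ ω) (x i ω) : ℝ)}) := by
      ext ω
      simp [IsArgmax, imp_iff_not_or]
    rw [this]
    exact (hmem J).inter (MeasurableSet.iInter fun K =>
      (hmem K).compl.union (measurableSet_le (hs K) (hs J)))
  have hw : ∀ J : Finset (Fin N), Measurable fun ω => wnorm (W ω) (∑ i ∈ J, x i ω) := fun J =>
    Run.measurable_wnorm hW (Finset.measurable_sum _ fun i _ => hx i)
  have hite : ∀ J, Measurable fun ω =>
      if IsArgmax (A ω) (fun i => inner ℝ (θ ω) (x i ω)) J then wnorm (W ω) (∑ i ∈ J, x i ω)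
      else B := fun J => Measurable.ite (hset J) (hw J) measurable_const
  exact Measurable.iInf hite

end ArgmaxWidth

/-- The optimism argument. With `θ'` an independent copy of the sample `θ₁`, on the event that `θ'`
is optimistic and concentrated, the loss of optimism of `θ₁` is at most
`⟨θ' - θ₁, X_J⟩ ≤ 2 γ ‖X_J‖` for every super arm `J` optimal for `θ'`. This event has probability
at least `optimismProb / 2`, so averaging over `θ'` bounds the loss by the mean width. -/
lemma optimism {V : Matrix (Fin d) (Fin d) ℝ} (hV : V.PosDef) {x₀ θ θ₁ : Vec d} {v γ B : ℝ}
    (hv : 0 ≤ v) (hγ : 0 ≤ γ) {A : Finset (Finset (Fin N))} {x : Fin N → Vec d}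
    (hB : ∀ J ∈ A, wnorm V⁻¹ (∑ i ∈ J, x i) ≤ B)
    (hθ : wnorm V (θ - x₀) ≤ 2 * v) (hθ₁ : wnorm V (θ₁ - x₀) ≤ γ)
    (htail : (multivariateGaussian x₀ (v ^ 2 • V⁻¹)).real {θ' | γ < wnorm V (θ' - x₀)} ≤
      optimismProb / 2)
    {I J : Finset (Fin N)} (hI : IsArgmax A (fun i => inner ℝ θ₁ (x i)) I)
    (hJ : IsArgmax A (fun i => inner ℝ θ (x i)) J) :
    optimismProb / 2 * (∑ i ∈ J, inner ℝ θ (x i) - ∑ i ∈ I, inner ℝ θ₁ (x i)) ≤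
      2 * γ * ∫ θ', argmaxWidth V⁻¹ A x B θ' ∂(multivariateGaussian x₀ (v ^ 2 • V⁻¹)) := by
  set ν := multivariateGaussian x₀ (v ^ 2 • V⁻¹) with hν
  have hB0 : 0 ≤ B := (wnorm_nonneg _ _).trans (hB I hI.1)
  have hp := optimismProb_pos
  set g := ∑ i ∈ J, inner ℝ θ (x i) - ∑ i ∈ I, inner ℝ θ₁ (x i) with hg
  have hint0 : 0 ≤ ∫ θ', argmaxWidth V⁻¹ A x B θ' ∂ν :=
    integral_nonneg fun θ' => argmaxWidth_nonneg hB0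
  rcases le_or_gt g 0 with hg0 | hg0
  · exact (mul_nonpos_of_nonneg_of_nonpos (by positivity) hg0).trans (by positivity)
  have hmeas : Measurable fun θ' => argmaxWidth V⁻¹ A x B θ' :=
    measurable_argmaxWidth (W := fun _ => V⁻¹) (A := fun _ => A) (x := fun i _ => x i)
      (θ := fun θ' => θ') (fun _ _ => measurable_const) measurable_const
      (fun _ => measurable_const) measurable_id B
  have hupper : ∀ θ', argmaxWidth V⁻¹ A x B θ' ≤ B := fun θ' => by
    obtain ⟨K, hK⟩ := exists_isArgmax ⟨I, hI.1⟩ fun i => (inner ℝ θ' (x i) : ℝ)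
    exact (argmaxWidth_le hK).trans (hB K hK.1)
  have hintg : Integrable (fun θ' => 2 * γ * argmaxWidth V⁻¹ A x B θ') ν :=
    (Integrable.of_bound hmeas.aestronglyMeasurable B (ae_of_all _ fun θ' => by
      rw [Real.norm_of_nonneg (argmaxWidth_nonneg hB0)]; exact hupper θ')).const_mul _
  have hgood : {θ' : Vec d | 2 * v * wnorm V⁻¹ (∑ i ∈ J, x i) ≤ inner ℝ (∑ i ∈ J, x i) (θ' - x₀)} ⊆
      {θ' | g ≤ 2 * γ * argmaxWidth V⁻¹ A x B θ'} ∪ {θ' | γ < wnorm V (θ' - x₀)} := by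
    intro θ' hθ'
    rcases lt_or_ge γ (wnorm V (θ' - x₀)) with h | h
    · exact Or.inr h
    left
    simp only [Set.mem_ofPred_eq] at hθ' ⊢
    have hopt : ∑ i ∈ J, inner ℝ θ (x i) ≤ ∑ i ∈ J, (inner ℝ θ' (x i) : ℝ) := by
      rw [← inner_sum, ← inner_sum]
      have h1 := inner_le_wnorm_mul hV (θ - x₀) (∑ i ∈ J, x i)
      have h2 := mul_le_mul_of_nonneg_right hθ (wnorm_nonneg V⁻¹ (∑ i ∈ J, x i))
      have h3 : (inner ℝ (θ - x₀) (∑ i ∈ J, x i) : ℝ) ≤ inner ℝ (θ' - x₀) (∑ i ∈ J, x i) := by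
        rw [real_inner_comm _ (θ' - x₀)]; exact h1.trans (h2.trans hθ')
      simpa [inner_sub_left] using h3
    have hK : ∀ K, IsArgmax A (fun i => inner ℝ θ' (x i)) K →
        g ≤ 2 * γ * wnorm V⁻¹ (∑ i ∈ K, x i) := by
      intro K hK
      have h1 := hK.2 J hJ.1
      have h2 := hI.2 K hK.1
      have h3 := inner_le_wnorm_mul hV ((θ' - x₀) - (θ₁ - x₀)) (∑ i ∈ K, x i)
      have h4 : wnorm V ((θ' - x₀) - (θ₁ - x₀)) ≤ 2 * γ :=
        (wnorm_sub_le hV _ _).trans (by linarith)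
      have h5 := mul_le_mul_of_nonneg_right h4 (wnorm_nonneg V⁻¹ (∑ i ∈ K, x i))
      rw [sub_sub_sub_cancel_right] at h3 h5
      rw [inner_sub_left, inner_sum, inner_sum] at h3
      simp only at h1 h2
      rw [hg]; linarith
    rcases hγ.eq_or_lt with h0 | h0
    · obtain ⟨K, hK'⟩ := exists_isArgmax ⟨I, hI.1⟩ fun i => (inner ℝ θ' (x i) : ℝ)
      have := hK K hK'
      simp only [← h0, mul_zero, zero_mul] at this ⊢
      exact this
    · rw [← div_le_iff₀' (by positivity)]
      refine le_argmaxWidth ?_ fun K hK' => by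
        rw [div_le_iff₀' (by positivity)]; exact hK K hK'
      obtain ⟨K, hK'⟩ := exists_isArgmax ⟨I, hI.1⟩ fun i => (inner ℝ θ' (x i) : ℝ)
      rw [div_le_iff₀' (by positivity)]
      exact (hK K hK').trans (by gcongr; exact hB K hK'.1)
  have h1 : optimismProb / 2 ≤ ν.real {θ' | g ≤ 2 * γ * argmaxWidth V⁻¹ A x B θ'} := by
    have h2 := optimismProb_le hV x₀ hv (∑ i ∈ J, x i)
    have h3 := (measureReal_mono (μ := ν) hgood).trans (measureReal_union_le _ _)
    linarith
  have h2 := mul_meas_ge_le_integral_of_nonneg (μ := ν)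
    (ae_of_all _ fun θ' => mul_nonneg (by positivity : 0 ≤ 2 * γ) (argmaxWidth_nonneg hB0))
    hintg g
  rw [integral_const_mul] at h2
  refine le_trans ?_ h2
  rw [mul_comm]
  exact mul_le_mul_of_nonneg_left h1 hg0.le

/-! ### Sums of conditional expectations -/

lemma exp_neg_le_one_sub_half {y : ℝ} (h0 : 0 ≤ y) (h1 : y ≤ 1) : Real.exp (-y) ≤ 1 - y / 2 := by
  have h := Real.add_one_le_exp y
  rw [Real.exp_neg, inv_le_iff_one_le_mul₀ (Real.exp_pos y)]
  nlinarith

section Supermartingale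

variable {Ω : Type*} {m0 : MeasurableSpace Ω} {μ : Measure Ω} [IsProbabilityMeasure μ]

/-- For `y_t ∈ [0, 1]`, the exponential of `∑ (𝔼[y_t | F_t] / 2 - y_t)` is a supermartingale. -/
lemma lintegral_exp_sum_condExp_le {F : ℕ → MeasurableSpace Ω} {T : ℕ} (hF : ∀ t ≤ T, F t ≤ m0)
    (hmono : ∀ s t, s ≤ t → F s ≤ F t) {y : ℕ → Ω → ℝ}
    (hy : ∀ t ∈ Finset.Icc 1 T, Measurable (y t))
    (hy' : ∀ t ∈ Finset.Icc 1 T, Measurable[F (t + 1)] (y t))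
    (hy0 : ∀ t ∈ Finset.Icc 1 T, ∀ ω, 0 ≤ y t ω) (hy1 : ∀ t ∈ Finset.Icc 1 T, ∀ ω, y t ω ≤ 1)
    {n : ℕ} (hn : n ≤ T) :
    ∫⁻ ω, ENNReal.ofReal (Real.exp (∑ t ∈ Finset.Icc 1 n, ((μ[y t | F t]) ω / 2 - y t ω))) ∂μ
      ≤ 1 := by
  induction n with
  | zero => simp
  | succ n ih =>
    have hT : n + 1 ∈ Finset.Icc 1 T := Finset.mem_Icc.2 ⟨by omega, hn⟩
    have hm := hF (n + 1) hn
    refine le_trans ?_ (ih (by omega))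
    set e := μ[y (n + 1) | F (n + 1)] with he
    have hem : Measurable[F (n + 1)] e := stronglyMeasurable_condExp.measurable
    have hprev : Measurable[F (n + 1)] fun ω =>
        ∑ t ∈ Finset.Icc 1 n, ((μ[y t | F t]) ω / 2 - y t ω) := by
      refine @Finset.measurable_sum _ _ _ _ _ _ (F (n + 1)) _ _ fun t ht => ?_
      have ht' := Finset.mem_Icc.1 ht
      have h1 : Measurable[F (n + 1)] (μ[y t | F t]) :=
        stronglyMeasurable_condExp.measurable.mono (hmono _ _ (by omega)) le_rfl
      have h2 : Measurable[F (n + 1)] (y t) :=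
        (hy' t (Finset.mem_Icc.2 ⟨ht'.1, by omega⟩)).mono (hmono _ _ (by omega)) le_rfl
      exact (h1.div_const 2).sub h2
    have hM : Measurable[F (n + 1)] fun ω => ENNReal.ofReal
        (Real.exp (∑ t ∈ Finset.Icc 1 n, ((μ[y t | F t]) ω / 2 - y t ω) + e ω / 2)) :=
      (hprev.add (hem.div_const 2)).exp.ennreal_ofReal
    have hyint : Integrable (y (n + 1)) μ :=
      Integrable.of_bound (hy _ hT).aestronglyMeasurable 1 (ae_of_all _ fun ω => by
        rw [Real.norm_of_nonneg (hy0 _ hT ω)]; exact hy1 _ hT ω)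
    have hDint : Integrable (fun ω => Real.exp (-y (n + 1) ω)) μ :=
      Integrable.of_bound (hy _ hT).neg.exp.aestronglyMeasurable 1 (ae_of_all _ fun ω => by
        rw [Real.norm_of_nonneg (Real.exp_pos _).le]
        exact Real.exp_le_one_iff.2 (by linarith [hy0 _ hT ω]))
    have hg : μ[fun ω => Real.exp (-y (n + 1) ω) | F (n + 1)] ≤ᵐ[μ] fun ω => 1 - e ω / 2 := by
      have h1 : μ[fun ω => Real.exp (-y (n + 1) ω) | F (n + 1)] ≤ᵐ[μ]
          μ[(fun _ => (1 : ℝ)) - (1 / 2 : ℝ) • y (n + 1) | F (n + 1)] := by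
        refine condExp_mono hDint ((integrable_const _).sub (hyint.smul _))
          (ae_of_all _ fun ω => ?_)
        have := exp_neg_le_one_sub_half (hy0 _ hT ω) (hy1 _ hT ω)
        simp only [Pi.sub_apply, Pi.smul_apply, smul_eq_mul]
        linarith
      have h2 := condExp_sub (m := F (n + 1)) (integrable_const (μ := μ) (1 : ℝ))
        (hyint.smul (1 / 2 : ℝ))
      have h3 := condExp_smul (μ := μ) (1 / 2 : ℝ) (y (n + 1)) (F (n + 1))
      filter_upwards [h1, h2, h3] with ω h1 h2 h3
      rw [h2, Pi.sub_apply, h3, condExp_const hm] at h1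
      simp only [Pi.smul_apply, smul_eq_mul] at h1
      linarith
    have key := lintegral_mul_le_of_condExp_le hm hDint (fun ω => (Real.exp_pos _).le)
      (measurable_const.sub (hem.div_const 2)) hg hM
    calc _ = _ := lintegral_congr fun ω => ?_
      _ ≤ _ := key
      _ ≤ _ := lintegral_mono fun ω => ?_
    · rw [← ENNReal.ofReal_mul (Real.exp_pos _).le, ← Real.exp_add,
        Finset.sum_Icc_succ_top (by omega)]
      congr 2; ring
    · rw [← ENNReal.ofReal_mul (Real.exp_pos _).le, Real.exp_add]
      refine ENNReal.ofReal_le_ofReal ?_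
      rw [mul_assoc]
      refine mul_le_of_le_one_right (Real.exp_pos _).le ?_
      have h1 := Real.add_one_le_exp (-(e ω / 2))
      calc Real.exp (e ω / 2) * (1 - e ω / 2) ≤ Real.exp (e ω / 2) * Real.exp (-(e ω / 2)) := by
            gcongr; linarith
        _ = 1 := by rw [← Real.exp_add]; simp

/-- With high probability, the sum of the conditional means of variables with values in `[0, B]` is
at most twice the sum of the variables, up to an additive term of order `B`. This avoids the term of
order `B √T` of the Azuma–Hoeffding inequality. -/
lemma measure_sum_condExp_le {F : ℕ → MeasurableSpace Ω} {T : ℕ} (hF : ∀ t ≤ T, F t ≤ m0)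
    (hmono : ∀ s t, s ≤ t → F s ≤ F t) {y : ℕ → Ω → ℝ}
    (hy : ∀ t ∈ Finset.Icc 1 T, Measurable (y t))
    (hy' : ∀ t ∈ Finset.Icc 1 T, Measurable[F (t + 1)] (y t)) {B : ℝ} (hB : 0 < B)
    (hy0 : ∀ t ∈ Finset.Icc 1 T, ∀ ω, 0 ≤ y t ω) (hy1 : ∀ t ∈ Finset.Icc 1 T, ∀ ω, y t ω ≤ B)
    {δ : ℝ} (hδ : 0 < δ) :
    μ {ω | 2 * ∑ t ∈ Finset.Icc 1 T, y t ω + 2 * B * Real.log (1 / δ) <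
      ∑ t ∈ Finset.Icc 1 T, (μ[y t | F t]) ω} ≤ ENNReal.ofReal δ := by
  have h1 := lintegral_exp_sum_condExp_le (μ := μ) hF hmono (y := fun t => B⁻¹ • y t)
    (fun t ht => (hy t ht).const_smul _) (fun t ht => (hy' t ht).const_smul _)
    (fun t ht ω => mul_nonneg (inv_nonneg.2 hB.le) (hy0 t ht ω))
    (fun t ht ω => by
      simp only [Pi.smul_apply, smul_eq_mul]
      rw [inv_mul_le_iff₀ hB]; simpa using hy1 t ht ω) le_rfl
  have hae : ∀ᵐ ω ∂μ, ∀ t ∈ Finset.Icc 1 T, (μ[B⁻¹ • y t | F t]) ω = B⁻¹ * (μ[y t | F t]) ω := by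
    rw [Filter.eventually_all_finset]
    exact fun t _ => condExp_smul B⁻¹ (y t) (F t)
  have hmeas : Measurable fun ω => ENNReal.ofReal (Real.exp
      (∑ t ∈ Finset.Icc 1 T, ((μ[B⁻¹ • y t | F t]) ω / 2 - (B⁻¹ • y t) ω))) := by
    refine (Finset.measurable_sum _ fun t ht => ?_).exp.ennreal_ofReal
    have h2 : Measurable (μ[B⁻¹ • y t | F t]) :=
      stronglyMeasurable_condExp.measurable.mono (hF t (Finset.mem_Icc.1 ht).2) le_rfl
    exact (h2.div_const 2).sub ((hy t ht).const_smul _)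
  have h2 := (mul_meas_ge_le_lintegral (μ := μ) hmeas (ENNReal.ofReal (1 / δ))).trans h1
  have hne : ENNReal.ofReal (1 / δ) ≠ 0 := by simpa using hδ
  have h3 : (1 : ℝ≥0∞) = ENNReal.ofReal (1 / δ) * ENNReal.ofReal δ := by
    rw [← ENNReal.ofReal_mul (by positivity), one_div_mul_cancel hδ.ne', ENNReal.ofReal_one]
  rw [h3] at h2
  refine le_trans (measure_mono_ae ?_) ((ENNReal.mul_le_mul_iff_right hne (by simp)).1 h2)
  filter_upwards [hae] with ω hω hlt
  have hlt' : 2 * ∑ t ∈ Finset.Icc 1 T, y t ω + 2 * B * Real.log (1 / δ) <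
      ∑ t ∈ Finset.Icc 1 T, (μ[y t | F t]) ω := hlt
  refine ENNReal.ofReal_le_ofReal ?_
  rw [← Real.exp_log (show 0 < 1 / δ by positivity)]
  refine Real.exp_le_exp.2 ?_
  rw [Finset.sum_congr rfl fun t ht => by rw [hω t ht]]
  simp only [Pi.smul_apply, smul_eq_mul, Finset.sum_sub_distrib, ← Finset.mul_sum, ← Finset.sum_div]
  have h4 : B⁻¹ * (2 * ∑ t ∈ Finset.Icc 1 T, y t ω + 2 * B * Real.log (1 / δ)) ≤
      B⁻¹ * ∑ t ∈ Finset.Icc 1 T, (μ[y t | F t]) ω := by gcongr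
  have h5 : B⁻¹ * (2 * ∑ t ∈ Finset.Icc 1 T, y t ω + 2 * B * Real.log (1 / δ)) =
      2 * (B⁻¹ * ∑ t ∈ Finset.Icc 1 T, y t ω) + 2 * Real.log (1 / δ) := by field_simp
  linarith

end Supermartingale

end

section

/-! ### Widths of the plays and tail bounds for the parameters -/

variable {Ω : Type*} {d N : ℕ}

/-- The width of the play of round `t` in the geometry of `V_{t-1}⁻¹`. -/
def Run.width (P : Run Ω d N) (lam : ℝ) (t : ℕ) (ω : Ω) : ℝ :=
  wnorm (P.V lam (t - 1) ω)⁻¹ (∑ i ∈ P.play t ω, P.feature t i ω)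

lemma Run.width_nonneg (P : Run Ω d N) (lam : ℝ) (t : ℕ) (ω : Ω) : 0 ≤ P.width lam t ω :=
  wnorm_nonneg _ _

lemma Run.wnorm_V_inv_sum_le (P : Run Ω d N) {lam : ℝ} (hlam : 0 < lam) (n t : ℕ) (ω : Ω)
    {k : ℕ} (hx : ∀ i, ‖P.feature t i ω‖ ≤ 1) {J : Finset (Fin N)} (hJ : J.card ≤ k) :
    wnorm (P.V lam n ω)⁻¹ (∑ i ∈ J, P.feature t i ω) ≤ k / √lam := by
  refine (P.wnorm_V_inv_le hlam n ω _).trans ?_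
  gcongr
  calc ‖∑ i ∈ J, P.feature t i ω‖ ≤ ∑ i ∈ J, ‖P.feature t i ω‖ := norm_sum_le _ _
    _ ≤ ∑ _i ∈ J, (1 : ℝ) := Finset.sum_le_sum fun i _ => hx i
    _ ≤ k := by simpa using hJ

/-- The elliptical potential lemma and the Cauchy–Schwarz inequality, over the at most `k` arms of a
round and over the `T` rounds. -/
lemma Run.sum_width_le {P : Run Ω d N} {k T : ℕ} {ω : Ω} (h : P.Bounded k T ω) {lam : ℝ}
    (hlam : 1 ≤ lam) :
    ∑ t ∈ Finset.Icc 1 T, P.width lam t ω ≤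
      √(T * (k * (2 * (1 + k / lam) * (d * Real.log (1 + k * T / lam))))) := by
  refine Real.le_sqrt_of_sq_le ?_
  have h1 := sq_sum_le_card_mul_sum_sq (s := Finset.Icc 1 T) (f := fun t => P.width lam t ω)
  simp only [Nat.card_Icc, add_tsub_cancel_right] at h1
  refine h1.trans (mul_le_mul_of_nonneg_left ?_ (Nat.cast_nonneg T))
  refine le_trans ?_ (mul_le_mul_of_nonneg_left (sum_wnorm_V_inv_sq_le h hlam) (Nat.cast_nonneg k))
  rw [Finset.mul_sum]
  refine Finset.sum_le_sum fun t ht => ?_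
  have hV := (P.V_posDef (by linarith : 0 < lam) (t - 1) ω).inv
  have h2 := pow_le_pow_left₀ (wnorm_nonneg _ _)
    (wnorm_sum_le hV (P.play t ω) fun i => P.feature t i ω) 2
  refine h2.trans (sq_sum_le_card_mul_sum_sq.trans ?_)
  gcongr
  exact (h t ht).1

lemma Run.Observed.measurable_width [MeasurableSpace Ω] {P : Run Ω d N} {n : ℕ}
    (h : P.Observed (n + 1)) (lam : ℝ) : Measurable (P.width lam (n + 1)) := by
  have hn : n + 1 ∈ Finset.Icc 1 (n + 1) := by simp
  exact measurable_wnorm ((h.mono (Nat.le_succ n)).measurable_V_inv lam)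
    (measurable_sum_mem (h.play _ hn) (h.feature _ hn))

section Algorithm

variable [m0 : MeasurableSpace Ω] {μ : Measure Ω} [IsProbabilityMeasure μ] {P : Run Ω d N}
  {k T : ℕ} {R S lam : ℝ} {θ : Vec d} {v : ℕ → ℝ}

/-- The law from which the parameter of round `t` is sampled. -/
def Run.sampleLaw (P : Run Ω d N) (lam : ℝ) (v : ℕ → ℝ) (t : ℕ) (ω : Ω) : Measure (Vec d) :=
  multivariateGaussian (P.thetaHat lam t ω) ((v t) ^ 2 • (P.V lam (t - 1) ω)⁻¹)

/-- The mean of `argmaxWidth` under the sampling law is at most the conditional mean of the width of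
the play, since the play is one of the super arms over which `argmaxWidth` minimizes. -/
lemma ae_integral_argmaxWidth_le (hE : IsEnvironment μ P k T R S θ)
    (hA : IsRoundwiseTS μ P T lam v) (hlam : 0 < lam) {t : ℕ} (ht : t ∈ Finset.Icc 1 T) :
    ∀ᵐ ω ∂μ, ∫ θ', argmaxWidth (P.V lam (t - 1) ω)⁻¹ (P.avail t ω) (fun i => P.feature t i ω)
      (k / √lam) θ' ∂(P.sampleLaw lam v t ω) ≤ (μ[P.width lam t | P.info t]) ω := by
  have ht' := Finset.mem_Icc.1 ht
  obtain ⟨n, rfl⟩ : ∃ n, t = n + 1 := ⟨t - 1, by omega⟩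
  have hm := info_le hE hA ht'.2
  have hB : (0 : ℝ) ≤ k / √lam := by positivity
  set f : Ω × Vec d → ℝ := fun p => argmaxWidth (P.V lam n p.1)⁻¹ (P.avail (n + 1) p.1)
    (fun i => P.feature (n + 1) i p.1) (k / √lam) p.2 with hf
  have hO := P.observed_info n
  have h1 : n + 1 ∈ Finset.Icc 1 (n + 1) := by simp
  have hfm : Measurable[(P.info (n + 1)).prod (inferInstance : MeasurableSpace (Vec d))] f := by
    have hfst : @Measurable (Ω × Vec d) Ω
        ((P.info (n + 1)).prod (inferInstance : MeasurableSpace (Vec d))) (P.info (n + 1))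
        Prod.fst := @measurable_fst Ω (Vec d) (P.info (n + 1)) _
    have hsnd : @Measurable (Ω × Vec d) (Vec d)
        ((P.info (n + 1)).prod (inferInstance : MeasurableSpace (Vec d))) _
        Prod.snd := @measurable_snd Ω (Vec d) (P.info (n + 1)) _
    refine @measurable_argmaxWidth d N (Ω × Vec d)
      ((P.info (n + 1)).prod (inferInstance : MeasurableSpace (Vec d)))
      (fun p => (P.V lam n p.1)⁻¹) (fun i j => ?_) (fun p => P.avail (n + 1) p.1) ?_
      (fun i p => P.feature (n + 1) i p.1) (fun i => ?_) (fun p => p.2) hsnd (k / √lam)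
    · exact (@Run.Observed.measurable_V_inv d Ω N (P.info (n + 1)) P n hO lam i j).comp hfst
    · exact (P.measurable_avail_info h1).comp hfst
    · exact (P.measurable_feature_info h1 i).comp hfst
  have hfw : ∀ ω, f (ω, P.sample (n + 1) ω) ≤ P.width lam (n + 1) ω := fun ω =>
    argmaxWidth_le (hA.play_argmax _ ht ω)
  have hwB : ∀ ω, P.width lam (n + 1) ω ≤ k / √lam := fun ω =>
    P.wnorm_V_inv_sum_le hlam n (n + 1) ω (fun i => hE.norm_feature_le _ ht i ω)
      (bounded hE hA ω _ ht).1
  have hwm : Measurable (P.width lam (n + 1)) :=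
    ((observed hE hA).mono ht'.2).measurable_width lam
  have hwint : Integrable (P.width lam (n + 1)) μ :=
    Integrable.of_bound hwm.aestronglyMeasurable (k / √lam) (ae_of_all _ fun ω => by
      rw [Real.norm_of_nonneg (P.width_nonneg _ _ _)]; exact hwB ω)
  have hfm' : Measurable fun ω => f (ω, P.sample (n + 1) ω) := by
    have h2 : @Measurable Ω (Ω × Vec d) m0
        ((P.info (n + 1)).prod (inferInstance : MeasurableSpace (Vec d)))
        fun ω => (ω, P.sample (n + 1) ω) :=
      @Measurable.prodMk Ω m0 Ω (Vec d) (P.info (n + 1)) _ _ _ (measurable_id'' hm)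
        (hA.measurable_sample _ ht)
    exact hfm.comp h2
  have hfint : Integrable (fun ω => f (ω, P.sample (n + 1) ω)) μ :=
    hwint.mono' hfm'.aestronglyMeasurable (ae_of_all _ fun ω => by
      rw [Real.norm_of_nonneg (argmaxWidth_nonneg hB)]; exact hfw ω)
  have hcond := condExp_eq_integral_of_condLaw hm (hA.measurable_sample _ ht)
    (G := P.sampleLaw lam v (n + 1)) (fun ω => by unfold Run.sampleLaw; infer_instance)
    (hA.law_sample _ ht) hfm hfint
  have hle := condExp_mono (m := P.info (n + 1)) hfint hwint (ae_of_all _ hfw)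
  filter_upwards [hcond, hle] with ω h2 h3
  rw [h2] at h3
  exact h3

lemma measure_sample_tail_le (hE : IsEnvironment μ P k T R S θ)
    (hA : IsRoundwiseTS μ P T lam v) (hlam : 0 < lam) {t : ℕ} (ht : t ∈ Finset.Icc 1 T)
    (hv : 0 ≤ v t) {a ε : ℝ} (ha : 0 ≤ a) (hε : d * (2 * Real.exp (-a ^ 2 / 2)) ≤ ε) :
    μ {ω | v t * √d * a < wnorm (P.V lam (t - 1) ω) (P.sample t ω - P.thetaHat lam t ω)} ≤
      ENNReal.ofReal ε := by
  have ht' := Finset.mem_Icc.1 ht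
  obtain ⟨n, rfl⟩ : ∃ n, t = n + 1 := ⟨t - 1, by omega⟩
  have hm := info_le hE hA ht'.2
  have hO := P.observed_info n
  set γ := v (n + 1) * √d * a
  set D : Set (Ω × Vec d) := {p | γ < wnorm (P.V lam n p.1) (p.2 - P.thetaHat lam (n + 1) p.1)}
    with hD
  have hDm : MeasurableSet[(P.info (n + 1)).prod (inferInstance : MeasurableSpace (Vec d))] D := by
    have hfst : @Measurable (Ω × Vec d) Ω
        ((P.info (n + 1)).prod (inferInstance : MeasurableSpace (Vec d))) (P.info (n + 1))
        Prod.fst := @measurable_fst Ω (Vec d) (P.info (n + 1)) _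
    have hsnd : @Measurable (Ω × Vec d) (Vec d)
        ((P.info (n + 1)).prod (inferInstance : MeasurableSpace (Vec d))) _
        Prod.snd := @measurable_snd Ω (Vec d) (P.info (n + 1)) _
    have h1 := (@Run.Observed.measurable_thetaHat d Ω N (P.info (n + 1)) P n hO lam).comp hfst
    have h2 := @Run.measurable_wnorm d (Ω × Vec d)
      ((P.info (n + 1)).prod (inferInstance : MeasurableSpace (Vec d)))
      (fun p => P.V lam n p.1)
      (fun i j => (@Run.Observed.measurable_V d Ω N (P.info (n + 1)) P n hO lam i j).comp hfst)
      (fun p => p.2 - P.thetaHat lam (n + 1) p.1) (hsnd.sub h1)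
    exact h2 measurableSet_Ioi
  have hpair : @Measurable Ω (Ω × Vec d) m0
      ((P.info (n + 1)).prod (inferInstance : MeasurableSpace (Vec d)))
      fun ω => (ω, P.sample (n + 1) ω) :=
    @Measurable.prodMk Ω m0 Ω (Vec d) (P.info (n + 1)) _ _ _ (measurable_id'' hm)
      (hA.measurable_sample _ ht)
  -- The probability of the tail event is the mean of its conditional probabilities.
  set f : Ω × Vec d → ℝ := D.indicator 1 with hf
  have hfm : Measurable[(P.info (n + 1)).prod (inferInstance : MeasurableSpace (Vec d))] f :=
    (@measurable_const _ _ _ ((P.info (n + 1)).prod (inferInstance : MeasurableSpace (Vec d)))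
      (1 : ℝ)).indicator hDm
  set E : Set Ω := (fun ω => (ω, P.sample (n + 1) ω)) ⁻¹' D with hEdef
  have hEm : MeasurableSet E := hpair hDm
  have hfE : (fun ω => f (ω, P.sample (n + 1) ω)) = E.indicator 1 := rfl
  have hfint : Integrable (fun ω => f (ω, P.sample (n + 1) ω)) μ := by
    rw [hfE]; exact (integrable_const (1 : ℝ)).indicator hEm
  have hcond := condExp_eq_integral_of_condLaw hm (hA.measurable_sample _ ht)
    (G := P.sampleLaw lam v (n + 1)) (fun ω => by unfold Run.sampleLaw; infer_instance)
    (hA.law_sample _ ht) hfm hfint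
  have hreal : μ.real E ≤ ε := by
    have h1 : μ.real E = ∫ ω, (μ[fun ω => f (ω, P.sample (n + 1) ω) | P.info (n + 1)]) ω ∂μ := by
      rw [integral_condExp hm, hfE, integral_indicator_one hEm]
    rw [h1, integral_congr_ae hcond]
    have h2 : ∀ ω, ∫ y, f (ω, y) ∂(P.sampleLaw lam v (n + 1) ω) ≤ ε := by
      intro ω
      have h3 : (fun y => f (ω, y)) =
          {y | γ < wnorm (P.V lam n ω) (y - P.thetaHat lam (n + 1) ω)}.indicator 1 := rfl
      have h4 : MeasurableSet {y : Vec d |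
          γ < wnorm (P.V lam n ω) (y - P.thetaHat lam (n + 1) ω)} :=
        measurableSet_lt measurable_const (Run.measurable_wnorm (M := fun _ => P.V lam n ω)
          (x := fun y => y - P.thetaHat lam (n + 1) ω) (fun _ _ => measurable_const)
          (measurable_id.sub_const _))
      rw [h3, integral_indicator_one h4]
      exact (sampling_tail_le (P.V_posDef hlam n ω) _ hv ha).trans hε
    have hε0 : 0 ≤ ε := le_trans (by positivity) hε
    calc _ ≤ ∫ _ω, ε ∂μ := integral_mono_of_nonneg
          (ae_of_all _ fun ω => integral_nonneg fun y => Set.indicator_nonneg (by simp) _)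
          (integrable_const _) (ae_of_all _ h2)
      _ = ε := by simp
  have h5 : μ E ≤ ENNReal.ofReal ε := by
    rw [← ENNReal.ofReal_toReal (measure_ne_top μ E)]
    exact ENNReal.ofReal_le_ofReal hreal
  exact h5

/-- The true parameter lies within `2 β_t(δ)` of the estimator. The hypothesis `hRS` excludes the
noiseless problem with `θ = 0`. -/
lemma measure_thetaHat_tail_le (hE : IsEnvironment μ P k T R S θ)
    (hA : IsRoundwiseTS μ P T lam v) (hd : 1 ≤ d) (hlam : 1 ≤ lam) (hR : 0 ≤ R) (hS : 0 ≤ S)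
    (hRS : 0 < R ∨ 0 < S) {δ : ℝ} (hδ : 0 < δ) (hδ1 : δ < 1) {t : ℕ} (ht : t ∈ Finset.Icc 1 T) :
    μ {ω | 2 * beta d k R S lam δ t < wnorm (P.V lam (t - 1) ω) (θ - P.thetaHat lam t ω)} ≤
      ENNReal.ofReal δ := by
  have ht' := Finset.mem_Icc.1 ht
  obtain ⟨n, rfl⟩ : ∃ n, t = n + 1 := ⟨t - 1, by omega⟩
  have hl0 : 0 < lam := by linarith
  have hd0 : (0 : ℝ) < d := by exact_mod_cast hd
  set q := √(d * Real.log ((1 + k * n / lam) / δ)) with hq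
  have hx1 : (1 : ℝ) ≤ 1 + k * n / lam := le_add_of_nonneg_right (by positivity)
  have hq0 : 0 < q := by
    refine Real.sqrt_pos.2 (mul_pos hd0 (Real.log_pos ?_))
    rw [lt_div_iff₀ hδ]; linarith
  have hqq : q ≤ √(d * Real.log ((1 + k * (n + 1 : ℕ) / lam) / δ)) := by
    refine Real.sqrt_le_sqrt ?_
    gcongr
    omega
  have hs2 : √2 ≤ 2 := Real.sqrt_le_iff.2 ⟨by norm_num, by norm_num⟩
  have hsl : 1 ≤ √lam := Real.one_le_sqrt.2 hlam
  -- For `R = 0` the noise bound is applied with a small positive constant absorbed by `√lam S`.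
  obtain ⟨r, hr, hRr, hb⟩ : ∃ r, 0 < r ∧ R ≤ r ∧
      √2 * (r * q) + √lam * S ≤ 2 * beta d k R S lam δ (n + 1) := by
    rcases hR.eq_or_lt with h0 | h0
    · have hS0 : 0 < S := hRS.resolve_left (by rw [← h0]; exact lt_irrefl 0)
      have h2 : 0 < √2 := by positivity
      refine ⟨S / (√2 * q), by positivity, by rw [← h0]; positivity, ?_⟩
      have h3 : √2 * (S / (√2 * q) * q) = S := by field_simp
      rw [h3, beta, ← h0]
      nlinarith
    · refine ⟨R, h0, le_rfl, ?_⟩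
      rw [beta]
      have h3 : √2 * (R * q) ≤ 2 * (R * √(d * Real.log ((1 + k * (n + 1 : ℕ) / lam) / δ))) := by
        gcongr
      have h4 : 0 ≤ √lam * S := by positivity
      linarith
  refine (measure_mono fun ω hω => ?_).trans
    (measure_lt_wnorm_noiseSum_le hE hA hl0 hd hr hR hRr (n := n) (by omega) hδ hδ1)
  have h1 := P.wnorm_thetaHat_sub_le θ hl0 hE.norm_param_le n ω
  have h2 : wnorm (P.V lam n ω) (θ - P.thetaHat lam (n + 1) ω) =
      wnorm (P.V lam n ω) (P.thetaHat lam (n + 1) ω - θ) := by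
    have h3 := wnorm_smul (P.V_posDef hl0 n ω) (-1) (P.thetaHat lam (n + 1) ω - θ)
    rw [neg_one_smul, neg_sub] at h3
    simpa using h3
  have h3 : 2 * beta d k R S lam δ (n + 1) <
      wnorm (P.V lam n ω) (θ - P.thetaHat lam (n + 1) ω) := hω
  change √2 * (r * q) < wnorm (P.V lam n ω)⁻¹ (P.noiseSum θ n ω)
  linarith

end Algorithm

end

/-! ### The regret -/

section

variable {Ω : Type*} {d N : ℕ}

/-- The regret on the good event, where the estimates and the samples are concentrated and `e t`
bounds the mean width of round `t`. -/
lemma regret_le_of_good {P : Run Ω d N} {k T : ℕ} {lam : ℝ} (hlam : 1 ≤ lam) {θ : Vec d}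
    {best : ℕ → Ω → Finset (Fin N)} {v : ℕ → ℝ} {w γ a : ℝ} {e : ℕ → ℝ} {ω : Ω}
    (hbd : P.Bounded k T ω)
    (hcard : ∀ t ∈ Finset.Icc 1 T, ∀ I ∈ P.avail t ω, I.card ≤ k)
    (hplay : ∀ t ∈ Finset.Icc 1 T, IsArgmax (P.avail t ω)
      (fun i => inner ℝ (P.sample t ω) (P.feature t i ω)) (P.play t ω))
    (hbest : ∀ t ∈ Finset.Icc 1 T, IsArgmax (P.avail t ω)
      (fun i => inner ℝ θ (P.feature t i ω)) (best t ω))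
    (hv : ∀ t ∈ Finset.Icc 1 T, 0 ≤ v t) (hvw : ∀ t ∈ Finset.Icc 1 T, v t ≤ w)
    (ha : 0 ≤ a) (hγ : w * √d * a = γ)
    (hatail : d * (2 * Real.exp (-a ^ 2 / 2)) ≤ optimismProb / 2)
    (h1 : ∀ t ∈ Finset.Icc 1 T,
      wnorm (P.V lam (t - 1) ω) (θ - P.thetaHat lam t ω) ≤ 2 * v t)
    (h2 : ∀ t ∈ Finset.Icc 1 T,
      wnorm (P.V lam (t - 1) ω) (P.sample t ω - P.thetaHat lam t ω) ≤ v t * √d * a)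
    (h3 : ∀ t ∈ Finset.Icc 1 T, ∫ θ', argmaxWidth (P.V lam (t - 1) ω)⁻¹ (P.avail t ω)
      (fun i => P.feature t i ω) (k / √lam) θ' ∂(P.sampleLaw lam v t ω) ≤ e t) :
    P.regret θ best T ω ≤ 4 * γ / optimismProb * ∑ t ∈ Finset.Icc 1 T, e t +
      (γ + 2 * w) * ∑ t ∈ Finset.Icc 1 T, P.width lam t ω := by
  have hl0 : 0 < lam := by linarith
  rw [Run.regret, Finset.mul_sum, Finset.mul_sum, ← Finset.sum_add_distrib]
  refine Finset.sum_le_sum fun t ht => ?_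
  have hV := P.V_posDef hl0 (t - 1) ω
  have hp := optimismProb_pos
  have hvt := hv t ht
  have hγt : v t * √d * a ≤ γ := by
    rw [← hγ]; gcongr; exact hvw t ht
  have hB : ∀ J ∈ P.avail t ω, wnorm (P.V lam (t - 1) ω)⁻¹ (∑ i ∈ J, P.feature t i ω) ≤ k / √lam :=
    fun J hJ => P.wnorm_V_inv_sum_le hl0 (t - 1) t ω (hbd t ht).2 (hcard t ht J hJ)
  have hint0 : 0 ≤ ∫ θ', argmaxWidth (P.V lam (t - 1) ω)⁻¹ (P.avail t ω)
      (fun i => P.feature t i ω) (k / √lam) θ' ∂(P.sampleLaw lam v t ω) :=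
    integral_nonneg fun _ => argmaxWidth_nonneg (by positivity)
  have hopt := optimism hV hvt (γ := v t * √d * a) (by positivity) hB (h1 t ht) (h2 t ht)
    ((sampling_tail_le hV (P.thetaHat lam t ω) hvt ha).trans hatail) (hplay t ht) (hbest t ht)
  have hopt' : ∑ i ∈ best t ω, inner ℝ θ (P.feature t i ω) -
      ∑ i ∈ P.play t ω, inner ℝ (P.sample t ω) (P.feature t i ω) ≤
      4 * γ / optimismProb * e t := by
    have h4 : optimismProb / 2 * (∑ i ∈ best t ω, inner ℝ θ (P.feature t i ω) -
      ∑ i ∈ P.play t ω, inner ℝ (P.sample t ω) (P.feature t i ω)) ≤ 2 * γ * e t := by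
      refine hopt.trans ?_
      have h5 := h3 t ht
      have hγ0 : 0 ≤ v t * √d * a := by positivity
      exact mul_le_mul (by linarith) h5 hint0 (by linarith)
    rw [div_mul_eq_mul_div, le_div_iff₀ hp]
    linarith
  have hexp : ∑ i ∈ P.play t ω, inner ℝ (P.sample t ω) (P.feature t i ω) -
      ∑ i ∈ P.play t ω, inner ℝ θ (P.feature t i ω) ≤ (γ + 2 * w) * P.width lam t ω := by
    rw [← inner_sum, ← inner_sum, ← inner_sub_left]
    refine (inner_le_wnorm_mul hV _ _).trans ?_
    refine mul_le_mul_of_nonneg_right ?_ (wnorm_nonneg _ _)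
    have h4 := wnorm_sub_le hV (P.sample t ω - P.thetaHat lam t ω) (θ - P.thetaHat lam t ω)
    rw [sub_sub_sub_cancel_right] at h4
    linarith [h1 t ht, h2 t ht, hvw t ht]
  linarith

lemma beta_nonneg {d k : ℕ} {R S lam δ : ℝ} (hR : 0 ≤ R) (hS : 0 ≤ S) (t : ℕ) :
    0 ≤ beta d k R S lam δ t := by
  unfold beta; positivity

lemma beta_mono {d k : ℕ} {R S lam δ : ℝ} (hR : 0 ≤ R) (hlam : 0 < lam) (hδ : 0 < δ) {s t : ℕ}
    (h : s ≤ t) : beta d k R S lam δ s ≤ beta d k R S lam δ t := by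
  unfold beta
  gcongr

/-- The regret bound before simplification; `a` is the level at which the Gaussian samples are
truncated, and `w = v_T` is the largest sampling scale. -/
lemma regret_highProb [m0 : MeasurableSpace Ω] {μ : Measure Ω} [IsProbabilityMeasure μ]
    {P : Run Ω d N} {k T : ℕ} {R S lam δ : ℝ} {θ : Vec d} {best : ℕ → Ω → Finset (Fin N)}
    (hd : 1 ≤ d) (hk : 1 ≤ k) (hT : 1 ≤ T) (hlam : 1 ≤ lam) (hR : 0 ≤ R) (hS : 0 ≤ S)
    (hδ : 0 < δ) (hδ1 : δ < 1) (hE : IsEnvironment μ P k T R S θ)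
    (hA : IsRoundwiseTS μ P T lam (beta d k R S lam (δ / (4 * T))))
    (hbest : ∀ t ∈ Finset.Icc 1 T, ∀ ω, IsArgmax (P.avail t ω)
      (fun i => inner ℝ θ (P.feature t i ω)) (best t ω))
    {a : ℝ} (ha : 0 ≤ a) (ha1 : d * (2 * Real.exp (-a ^ 2 / 2)) ≤ optimismProb / 2)
    (ha2 : d * (2 * Real.exp (-a ^ 2 / 2)) ≤ δ / (4 * T)) {w Z : ℝ}
    (hw : beta d k R S lam (δ / (4 * T)) T = w)
    (hZ : √(T * (k * (2 * (1 + k / lam) * (d * Real.log (1 + k * T / lam))))) = Z) :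
    1 - δ ≤ μ.real {ω | P.regret θ best T ω ≤ 4 * (w * √d * a) / optimismProb *
      (2 * Z + 2 * (k / √lam) * Real.log (4 / δ)) + (w * √d * a + 2 * w) * Z} := by
  have hl0 : 0 < lam := by linarith
  have hp := optimismProb_pos
  have hT0 : (0 : ℝ) < T := by exact_mod_cast hT
  have hT1 : (1 : ℝ) ≤ T := by exact_mod_cast hT
  have hk0 : (0 : ℝ) < k := by exact_mod_cast hk
  have hw0 : 0 ≤ w := hw ▸ beta_nonneg hR hS T
  have hZ0 : 0 ≤ Z := hZ ▸ Real.sqrt_nonneg _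
  have hB0 : 0 < k / √lam := div_pos hk0 (Real.sqrt_pos.2 hl0)
  have hlog4 : 0 ≤ Real.log (4 / δ) := Real.log_nonneg (by rw [le_div_iff₀ hδ]; linarith)
  set U := 4 * (w * √d * a) / optimismProb *
      (2 * Z + 2 * (k / √lam) * Real.log (4 / δ)) + (w * √d * a + 2 * w) * Z with hU
  have hU0 : 0 ≤ U := by positivity
  by_cases hRS : 0 < R ∨ 0 < S
  swap
  · -- Without noise and with `θ = 0`, the regret vanishes.
    have hS0 : S = 0 := le_antisymm (not_lt.1 fun h => hRS (Or.inr h)) hS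
    have hθ : θ = 0 := norm_le_zero_iff.1 (hE.norm_param_le.trans hS0.le)
    have : {ω | P.regret θ best T ω ≤ U} = Set.univ := by
      ext ω; simp [Run.regret, hθ, hU0]
    rw [this]; simp; exact hδ.le
  set δ' := δ / (4 * T) with hδ'
  have hδ'0 : 0 < δ' := by positivity
  have hδ'1 : δ' < 1 := by rw [hδ', div_lt_one (by positivity)]; linarith
  set v := beta d k R S lam δ' with hv
  set Bad1 : Set Ω := ⋃ t ∈ Finset.Icc 1 T,
    {ω | 2 * v t < wnorm (P.V lam (t - 1) ω) (θ - P.thetaHat lam t ω)} with hBad1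
  set Bad2 : Set Ω := ⋃ t ∈ Finset.Icc 1 T,
    {ω | v t * √d * a < wnorm (P.V lam (t - 1) ω) (P.sample t ω - P.thetaHat lam t ω)} with hBad2
  set Bad3 : Set Ω := {ω | 2 * ∑ t ∈ Finset.Icc 1 T, P.width lam t ω +
    2 * (k / √lam) * Real.log (1 / (δ / 4)) <
      ∑ t ∈ Finset.Icc 1 T, (μ[P.width lam t | P.info t]) ω} with hBad3
  have hsum : ∀ B : ℕ → Set Ω, (∀ t ∈ Finset.Icc 1 T, μ (B t) ≤ ENNReal.ofReal δ') →
      μ (⋃ t ∈ Finset.Icc 1 T, B t) ≤ ENNReal.ofReal (δ / 4) := by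
    intro B hB
    calc μ (⋃ t ∈ Finset.Icc 1 T, B t) ≤ ∑ t ∈ Finset.Icc 1 T, μ (B t) :=
          measure_biUnion_finset_le _ _
      _ ≤ ∑ _t ∈ Finset.Icc 1 T, ENNReal.ofReal δ' := Finset.sum_le_sum hB
      _ = ENNReal.ofReal (δ / 4) := by
          rw [Finset.sum_const, Nat.card_Icc, add_tsub_cancel_right, nsmul_eq_mul,
            ← ENNReal.ofReal_natCast, ← ENNReal.ofReal_mul (by positivity)]
          congr 1
          rw [hδ']; field_simp
  have hm1 : μ Bad1 ≤ ENNReal.ofReal (δ / 4) := hsum _ fun t ht =>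
    measure_thetaHat_tail_le hE hA hd hlam hR hS hRS hδ'0 hδ'1 ht
  have hm2 : μ Bad2 ≤ ENNReal.ofReal (δ / 4) := hsum _ fun t ht =>
    measure_sample_tail_le hE hA hl0 ht (beta_nonneg hR hS t) ha ha2
  have hwB : ∀ t ∈ Finset.Icc 1 T, ∀ ω, P.width lam t ω ≤ k / √lam := fun t ht ω =>
    P.wnorm_V_inv_sum_le hl0 (t - 1) t ω (fun i => hE.norm_feature_le _ ht i ω)
      (bounded hE hA ω t ht).1
  have hm3 : μ Bad3 ≤ ENNReal.ofReal (δ / 4) := by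
    refine measure_sum_condExp_le (fun t ht => info_le hE hA ht) (fun s t h => P.info_mono h)
      (fun t ht => ?_) (fun t ht => ?_) hB0 (fun t _ ω => P.width_nonneg _ _ _) hwB
      (by positivity)
    · have ht' := Finset.mem_Icc.1 ht
      obtain ⟨n, rfl⟩ : ∃ n, t = n + 1 := ⟨t - 1, by omega⟩
      exact ((observed hE hA).mono ht'.2).measurable_width lam
    · have ht' := Finset.mem_Icc.1 ht
      obtain ⟨n, rfl⟩ : ∃ n, t = n + 1 := ⟨t - 1, by omega⟩
      exact @Run.Observed.measurable_width Ω d N (P.info (n + 1 + 1)) P n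
        (P.observed_info (n + 1)) lam
  have hae : ∀ᵐ ω ∂μ, ∀ t ∈ Finset.Icc 1 T,
      ∫ θ', argmaxWidth (P.V lam (t - 1) ω)⁻¹ (P.avail t ω) (fun i => P.feature t i ω)
      (k / √lam) θ' ∂(P.sampleLaw lam v t ω) ≤ (μ[P.width lam t | P.info t]) ω := by
    rw [Filter.eventually_all_finset]
    exact fun t ht => ae_integral_argmaxWidth_le hE hA hl0 ht
  have hbadset : ∀ᵐ ω ∂μ, ω ∈ {ω | P.regret θ best T ω ≤ U}ᶜ → ω ∈ Bad1 ∪ Bad2 ∪ Bad3 := by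
    filter_upwards [hae] with ω hω hreg
    by_contra hnot
    simp only [Set.mem_union, not_or] at hnot
    obtain ⟨⟨hn1, hn2⟩, hn3⟩ := hnot
    simp only [hBad1, hBad2, hBad3, Set.mem_iUnion, Set.mem_ofPred_eq, not_exists, not_lt]
      at hn1 hn2 hn3
    refine hreg ?_
    have hmain := regret_le_of_good (e := fun t => (μ[P.width lam t | P.info t]) ω) hlam
      (bounded hE hA ω) (fun t ht => hE.card_le t ht ω) (fun t ht => hA.play_argmax t ht ω)
      (fun t ht => hbest t ht ω) (fun t _ => beta_nonneg hR hS t)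
      (fun t ht => (beta_mono hR hl0 hδ'0 (Finset.mem_Icc.1 ht).2).trans hw.le)
      ha rfl ha1 hn1 hn2 hω
    have hwZ : ∑ t ∈ Finset.Icc 1 T, P.width lam t ω ≤ Z :=
      hZ ▸ Run.sum_width_le (bounded hE hA ω) hlam
    have heq : (1 : ℝ) / (δ / 4) = 4 / δ := by field_simp
    rw [heq] at hn3
    refine hmain.trans ?_
    rw [hU]
    gcongr
    linarith
  have hcompl : μ {ω | P.regret θ best T ω ≤ U}ᶜ ≤ ENNReal.ofReal δ := by
    calc μ {ω | P.regret θ best T ω ≤ U}ᶜ ≤ μ (Bad1 ∪ Bad2 ∪ Bad3) := measure_mono_ae hbadset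
      _ ≤ μ Bad1 + μ Bad2 + μ Bad3 :=
          (measure_union_le _ _).trans (add_le_add (measure_union_le _ _) le_rfl)
      _ ≤ ENNReal.ofReal (δ / 4) + ENNReal.ofReal (δ / 4) + ENNReal.ofReal (δ / 4) :=
          add_le_add (add_le_add hm1 hm2) hm3
      _ = ENNReal.ofReal (δ / 4 + δ / 4 + δ / 4) := by
          rw [← ENNReal.ofReal_add (by positivity) (by positivity),
            ← ENNReal.ofReal_add (by positivity) (by positivity)]
      _ ≤ ENNReal.ofReal δ := ENNReal.ofReal_le_ofReal (by linarith)
  have hreal : μ.real {ω | P.regret θ best T ω ≤ U}ᶜ ≤ δ :=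
    ENNReal.toReal_le_of_le_ofReal hδ.le hcompl
  have huniv := measureReal_union_le (μ := μ) {ω | P.regret θ best T ω ≤ U}
    {ω | P.regret θ best T ω ≤ U}ᶜ
  rw [Set.union_compl_self, probReal_univ] at huniv
  linarith

/-! ### Simplification of the bound -/

/-- The truncation level of the Gaussian samples. -/
def truncLevel (d T : ℕ) (δ : ℝ) : ℝ := √(2 * Real.log (16 * d * T / (δ * optimismProb)))

section Arithmetic

variable {k T : ℕ} {lam δ : ℝ}

lemma truncLevel_spec (hd : 1 ≤ d) (hT : 1 ≤ T) (hδ : 0 < δ) (hδ1 : δ < 1) :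
    d * (2 * Real.exp (-truncLevel d T δ ^ 2 / 2)) = δ * optimismProb / (8 * T) := by
  have hp := optimismProb_pos
  have hp1 := optimismProb_le_one
  have hd1 : (1 : ℝ) ≤ d := by exact_mod_cast hd
  have hT1 : (1 : ℝ) ≤ T := by exact_mod_cast hT
  have hdT : (1 : ℝ) ≤ d * T := one_le_mul_of_one_le_of_one_le hd1 hT1
  have hx : 1 ≤ 16 * d * T / (δ * optimismProb) := by
    rw [le_div_iff₀ (by positivity)]
    nlinarith
  rw [truncLevel, Real.sq_sqrt (mul_nonneg (by norm_num) (Real.log_nonneg hx))]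
  rw [neg_div, mul_div_cancel_left₀ _ (two_ne_zero), Real.exp_neg, Real.exp_log (by linarith)]
  field_simp
  norm_num

lemma one_le_ratio (hd : 1 ≤ d) (hN : 1 ≤ N) (hk : 1 ≤ k) (hT : 1 ≤ T) (hδ : 0 < δ)
    (hδ1 : δ < 1) : 1 ≤ (d * T * N * k / δ : ℝ) := by
  have h : (1 : ℝ) ≤ d * T * N * k := by
    exact_mod_cast Nat.one_le_iff_ne_zero.2 (by positivity)
  rw [le_div_iff₀ hδ]; linarith

/-- All logarithms of the bound are dominated by `L = 1 + log (d T N k / δ)`. -/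
lemma log_bounds (hd : 1 ≤ d) (hN : 1 ≤ N) (hk : 1 ≤ k) (hT : 1 ≤ T) (hlam : 1 ≤ lam)
    (hδ : 0 < δ) (hδ1 : δ < 1) {L : ℝ} (hL : 1 + Real.log (d * T * N * k / δ) = L) :
    1 ≤ L ∧ Real.log (4 / δ) ≤ 3 * L ∧ Real.log (1 + k * T / lam) ≤ 2 * L ∧
      Real.log ((1 + k * T / lam) / (δ / (4 * T))) ≤ 9 * L ∧
      truncLevel d T δ ^ 2 ≤ (2 + 2 * Real.log (16 / optimismProb)) * L := by
  have hp := optimismProb_pos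
  have hp1 := optimismProb_le_one
  have hl0 : 0 < lam := by linarith
  have hd1 : (1 : ℝ) ≤ d := by exact_mod_cast hd
  have hT1 : (1 : ℝ) ≤ T := by exact_mod_cast hT
  have hk1 : (1 : ℝ) ≤ k := by exact_mod_cast hk
  have hN1 : (1 : ℝ) ≤ N := by exact_mod_cast hN
  have hx1 : (1 : ℝ) ≤ d * T * N * k / δ := one_le_ratio hd hN hk hT hδ hδ1
  have hxge : ∀ y : ℝ, y ≤ d * T * N * k → y / δ ≤ d * T * N * k / δ := fun y hy => by gcongr
  have hdT : (1 : ℝ) ≤ d * T := one_le_mul_of_one_le_of_one_le hd1 hT1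
  have hkT : (1 : ℝ) ≤ k * T := one_le_mul_of_one_le_of_one_le hk1 hT1
  have hNk : (1 : ℝ) ≤ N * k := one_le_mul_of_one_le_of_one_le hN1 hk1
  have hdN : (1 : ℝ) ≤ d * N := one_le_mul_of_one_le_of_one_le hd1 hN1
  have hb1 : (d : ℝ) * T ≤ d * T * N * k := by
    calc (d : ℝ) * T ≤ d * T * (N * k) := le_mul_of_one_le_right (by positivity) hNk
      _ = _ := by ring
  have hb2 : (k : ℝ) * T ≤ d * T * N * k := by
    calc (k : ℝ) * T ≤ k * T * (d * N) := le_mul_of_one_le_right (by positivity) hdN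
      _ = _ := by ring
  have hb3 : (T : ℝ) ≤ d * T * N * k :=
    (le_mul_of_one_le_left (by positivity) hd1).trans hb1
  have hxdT := hxge _ hb1
  have hxkT := hxge _ hb2
  have hxT := hxge _ hb3
  have hx0 := hxge 1 (hT1.trans hb3)
  generalize (d * T * N * k / δ : ℝ) = x at *
  have hlx : 0 ≤ Real.log x := Real.log_nonneg hx1
  have hlog2 : Real.log 2 ≤ 1 := by linarith [Real.log_two_lt_d9]
  have hlog4 : Real.log 4 ≤ 2 := by
    rw [show (4 : ℝ) = 2 ^ 2 by norm_num, Real.log_pow]; push_cast; linarith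
  have hlog8 : Real.log 8 ≤ 3 := by
    rw [show (8 : ℝ) = 2 ^ 3 by norm_num, Real.log_pow]; push_cast; linarith
  have hkTx : 1 + k * T / lam ≤ 2 * x := by
    have h1 : k * T / lam ≤ (k : ℝ) * T := div_le_self (by positivity) hlam
    have h2 : (k : ℝ) * T ≤ k * T / δ := le_div_self (by positivity) hδ hδ1.le
    linarith
  refine ⟨by linarith, ?_, ?_, ?_, ?_⟩
  · rw [show 4 / δ = 4 * (1 / δ) by ring, Real.log_mul (by norm_num) (by positivity)]
    have := Real.log_le_log (by positivity) hx0
    linarith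
  · have h2 := Real.log_le_log (by positivity) hkTx
    rw [Real.log_mul (by norm_num) (by positivity)] at h2
    linarith
  · have h1 : (1 + k * T / lam) / (δ / (4 * T)) ≤ 8 * x ^ 2 := by
      calc (1 + k * T / lam) / (δ / (4 * T)) = 4 * (1 + k * T / lam) * (T / δ) := by field_simp
        _ ≤ 4 * (2 * x) * x := by gcongr
        _ = 8 * x ^ 2 := by ring
    have h2 := Real.log_le_log (by positivity) h1
    rw [Real.log_mul (by norm_num) (by positivity), Real.log_pow] at h2
    push_cast at h2
    linarith
  · have hlog16 : 0 ≤ Real.log (16 / optimismProb) :=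
      Real.log_nonneg (by rw [le_div_iff₀ hp]; linarith)
    have h2 : 16 * d * T / (δ * optimismProb) = 16 / optimismProb * (d * T / δ) := by
      field_simp
    have h4 : (1 : ℝ) ≤ d * T / δ := by rw [le_div_iff₀ hδ]; linarith
    have h3 : Real.log (d * T / δ) ≤ Real.log x := Real.log_le_log (by positivity) hxdT
    rw [truncLevel, h2, Real.log_mul (by positivity) (by positivity), Real.sq_sqrt
      (mul_nonneg (by norm_num) (add_nonneg hlog16 (Real.log_nonneg h4)))]
    rw [← hL]
    nlinarith

lemma beta_le {R S L D : ℝ} {t : ℕ} (hR : 0 ≤ R) (hS : 0 ≤ S) (hL : 1 ≤ L)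
    (hlog : Real.log ((1 + k * t / lam) / δ) ≤ 9 * L) (hD1 : (d : ℝ) ≤ D)
    (hD2 : √(d * lam) ≤ D) :
    beta d k R S lam δ t * √d ≤ (3 * R + S) * √L * D := by
  have hsL : 1 ≤ √L := Real.one_le_sqrt.2 hL
  have hsd2 : √(d : ℝ) * √d = d := Real.mul_self_sqrt (by positivity)
  have hq : √(d * Real.log ((1 + k * t / lam) / δ)) ≤ 3 * √d * √L := by
    refine Real.sqrt_le_iff.2 ⟨by positivity, ?_⟩
    rw [mul_pow, mul_pow, Real.sq_sqrt (by positivity), Real.sq_sqrt (by linarith)]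
    calc (d : ℝ) * Real.log ((1 + k * t / lam) / δ) ≤ d * (9 * L) := by gcongr
      _ = 3 ^ 2 * d * L := by ring
  rw [Real.sqrt_mul (by positivity)] at hD2
  have hw : beta d k R S lam δ t ≤ (3 * R * √d + S * √lam) * √L := by
    have h3 : √lam * S ≤ √lam * S * √L := le_mul_of_one_le_right (by positivity) hsL
    calc beta d k R S lam δ t ≤ R * (3 * √d * √L) + √lam * S * √L := by
          rw [beta]; gcongr
      _ = _ := by ring
  calc beta d k R S lam δ t * √d ≤ (3 * R * √d + S * √lam) * √L * √d := by gcongr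
    _ = (3 * R * (√d * √d) + S * (√d * √lam)) * √L := by ring
    _ ≤ (3 * R * D + S * D) * √L := by rw [hsd2]; gcongr
    _ = (3 * R + S) * √L * D := by ring

/-- `Q` stands for `√(d k² T / lam)` or `√(d k T)`; the two hypotheses on it are all that depends on
whether `lam ≤ k`. -/
lemma bound_simplify {R S : ℝ} (hd : 1 ≤ d) (hN : 1 ≤ N) (hk : 1 ≤ k) (hT : 1 ≤ T)
    (hlam : 1 ≤ lam) (hR : 0 ≤ R) (hS : 0 ≤ S) (hδ : 0 < δ) (hδ1 : δ < 1) {a w Z Q D L : ℝ}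
    (ha : truncLevel d T δ = a) (hw : beta d k R S lam (δ / (4 * T)) T = w)
    (hZ : √(T * (k * (2 * (1 + k / lam) * (d * Real.log (1 + k * T / lam))))) = Z)
    (hL : 1 + Real.log (d * T * N * k / δ) = L) (hD : max (d : ℝ) √(d * lam) = D)
    (hQ1 : k / √lam ≤ Q) (hQ2 : √(d * k * T * (1 + k / lam)) ≤ 2 * Q) :
    4 * (w * √d * a) / optimismProb *
      (2 * Z + 2 * (k / √lam) * Real.log (4 / δ)) + (w * √d * a + 2 * w) * Z ≤
    (2 * (3 * R + S) * ((56 / optimismProb + 4) * (2 + 2 * Real.log (16 / optimismProb)) + 8)) *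
      L ^ 2 * (D * Q) := by
  have hp := optimismProb_pos
  have hp1 := optimismProb_le_one
  obtain ⟨hL1, hlogδ, hlogZ, hlogw, ha2⟩ := log_bounds hd hN hk hT hlam hδ hδ1 hL
  have hlog16 : 0 ≤ Real.log (16 / optimismProb) :=
    Real.log_nonneg (by rw [le_div_iff₀ hp]; linarith)
  have hlogδ0 : 0 ≤ Real.log (4 / δ) := Real.log_nonneg (by rw [le_div_iff₀ hδ]; linarith)
  rw [ha] at ha2
  have ha0 : 0 ≤ a := ha ▸ Real.sqrt_nonneg _
  have hd1 : (1 : ℝ) ≤ d := by exact_mod_cast hd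
  have hD1 : (d : ℝ) ≤ D := hD ▸ le_max_left _ _
  have hw0 : 0 ≤ w := hw ▸ beta_nonneg hR hS T
  have hwd : w * √d ≤ (3 * R + S) * √L * D :=
    hw ▸ beta_le hR hS hL1 hlogw hD1 (hD ▸ le_max_right _ _)
  have hsd : 1 ≤ √(d : ℝ) := Real.one_le_sqrt.2 hd1
  have hww : w ≤ w * √d := le_mul_of_one_le_right hw0 hsd
  have hQ0 : 0 ≤ Q := le_trans (by positivity) hQ1
  have hD0 : 0 ≤ D := le_trans (by positivity) hD1
  have hB0 : 0 ≤ k / √lam := by positivity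
  have hZ0 : 0 ≤ Z := hZ ▸ Real.sqrt_nonneg _
  have hsL : 1 ≤ √L := Real.one_le_sqrt.2 hL1
  have hsL2 : √L * √L = L := Real.mul_self_sqrt (by linarith)
  have hsLL : √L ≤ L := by nlinarith
  have hZ1 : Z ≤ 2 * √L * √(d * k * T * (1 + k / lam)) := by
    have h2 : (0 : ℝ) ≤ d * k * T * (1 + k / lam) := by positivity
    rw [← hZ]
    refine Real.sqrt_le_iff.2 ⟨by positivity, ?_⟩
    rw [mul_pow, mul_pow, Real.sq_sqrt (by linarith), Real.sq_sqrt h2]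
    calc (T : ℝ) * (k * (2 * (1 + k / lam) * (d * Real.log (1 + k * T / lam))))
        ≤ T * (k * (2 * (1 + k / lam) * (d * (2 * L)))) := by gcongr
      _ = _ := by ring
  have hY0 : 0 ≤ √(d * k * T * (1 + k / lam) : ℝ) := Real.sqrt_nonneg _
  generalize (k / √lam : ℝ) = B at *
  generalize √(d * k * T * (1 + k / lam) : ℝ) = Y at *
  generalize Real.log (4 / δ) = l at *
  generalize √(d : ℝ) = s at *
  have hc1 : 1 ≤ 2 + 2 * Real.log (16 / optimismProb) := by linarith
  generalize 2 + 2 * Real.log (16 / optimismProb) = c at *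
  clear hZ hw ha hD hL hlogw hlogZ
  have hRS0 : 0 ≤ 3 * R + S := by positivity
  have haL : a ≤ c * √L := by
    refine le_of_sq_le_sq ?_ (by positivity)
    rw [mul_pow, sq (√L), hsL2]
    nlinarith
  have hγ : w * s * a ≤ (3 * R + S) * c * L * D := by
    calc w * s * a ≤ ((3 * R + S) * √L * D) * (c * √L) := by gcongr
      _ = (3 * R + S) * c * (√L * √L) * D := by ring
      _ = _ := by rw [hsL2]
  have hZL : Z ≤ 4 * L * Q := by
    calc Z ≤ 2 * √L * Y := hZ1
      _ ≤ 2 * L * (2 * Q) := by gcongr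
      _ = 4 * L * Q := by ring
  have hsum : 2 * Z + 2 * B * l ≤ 14 * L * Q := by
    have h1 : B * l ≤ Q * (3 * L) := by gcongr
    linarith
  have hγ0 : 0 ≤ w * s * a := by positivity
  have h1 : w ≤ (3 * R + S) * L * D := hww.trans (hwd.trans (by gcongr))
  calc 4 * (w * s * a) / optimismProb * (2 * Z + 2 * B * l) + (w * s * a + 2 * w) * Z
      ≤ 4 * ((3 * R + S) * c * L * D) / optimismProb * (14 * L * Q) +
        (((3 * R + S) * c * L * D) + 2 * ((3 * R + S) * L * D)) * (4 * L * Q) := by gcongr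
    _ = ((3 * R + S) * ((56 / optimismProb + 4) * c + 8)) * L ^ 2 * (D * Q) := by ring
    _ ≤ (2 * (3 * R + S) * ((56 / optimismProb + 4) * c + 8)) * L ^ 2 * (D * Q) := by
        gcongr
        linarith

end Arithmetic

end

end CLS

end

theorem theorem2 :
    ∃ m : ℕ, ∀ R S : ℝ, 0 ≤ R → 0 ≤ S → ∃ C : ℝ, 0 < C ∧
      ∀ (d N k T : ℕ), 1 ≤ d → 1 ≤ N → 1 ≤ k → 1 ≤ T →
      ∀ (lam δ : ℝ), 1 ≤ lam → 0 < δ → δ < 1 →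
      ∀ (Ω : Type*) [MeasurableSpace Ω] (μ : Measure Ω) [IsProbabilityMeasure μ]
        (P : CLS.Run Ω d N) (θ : CLS.Vec d) (best : ℕ → Ω → Finset (Fin N)),
        CLS.IsEnvironment μ P k T R S θ →
        CLS.IsRoundwiseTS μ P T lam (CLS.beta d k R S lam (δ / (4 * T))) →
        (∀ t ∈ Finset.Icc 1 T, ∀ ω, CLS.IsArgmax (P.avail t ω)
          (fun i => inner ℝ θ (P.feature t i ω)) (best t ω)) →
        (lam ≤ k → 1 - δ ≤ μ.real {ω | P.regret θ best T ω ≤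
          C * (1 + Real.log (d * T * N * k / δ)) ^ m *
            (max (d : ℝ) (Real.sqrt (d * lam)) * Real.sqrt (d * k ^ 2 * T / lam))}) ∧
        (k ≤ lam → 1 - δ ≤ μ.real {ω | P.regret θ best T ω ≤
          C * (1 + Real.log (d * T * N * k / δ)) ^ m *
            (max (d : ℝ) (Real.sqrt (d * lam)) * Real.sqrt (d * k * T))}) := by
  have hp := CLS.optimismProb_pos
  have hp1 := CLS.optimismProb_le_one
  have hlog : 0 ≤ Real.log (16 / CLS.optimismProb) :=
    Real.log_nonneg (by rw [le_div_iff₀ hp]; linarith)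
  refine ⟨2, fun R S hR hS => ?_⟩
  set C₀ := 2 * (3 * R + S) * ((56 / CLS.optimismProb + 4) *
    (2 + 2 * Real.log (16 / CLS.optimismProb)) + 8) with hC₀
  -- `C₀` vanishes for `R = S = 0`, but the constant has to be positive.
  refine ⟨C₀ + 1, by positivity, ?_⟩
  intro d N k T hd hN hk hT lam δ hlam hδ hδ1 Ω _ μ _ P θ best hE hA hbest
  have hl0 : 0 < lam := by linarith
  have hd1 : (1 : ℝ) ≤ d := by exact_mod_cast hd
  have hT1 : (1 : ℝ) ≤ T := by exact_mod_cast hT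
  have hk1 : (1 : ℝ) ≤ k := by exact_mod_cast hk
  have hdT : (1 : ℝ) ≤ d * T := one_le_mul_of_one_le_of_one_le hd1 hT1
  have ha := CLS.truncLevel_spec hd hT hδ hδ1
  have ha1 : d * (2 * Real.exp (-CLS.truncLevel d T δ ^ 2 / 2)) ≤ CLS.optimismProb / 2 := by
    rw [ha, div_le_div_iff₀ (by positivity) (by norm_num)]
    nlinarith
  have ha2 : d * (2 * Real.exp (-CLS.truncLevel d T δ ^ 2 / 2)) ≤ δ / (4 * T) := by
    rw [ha, div_le_div_iff₀ (by positivity) (by positivity)]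
    nlinarith [mul_pos hδ (show (0 : ℝ) < T by linarith)]
  have hprob := CLS.regret_highProb hd hk hT hlam hR hS hδ hδ1 hE hA hbest (Real.sqrt_nonneg _)
    ha1 ha2 rfl rfl
  have hfinal : ∀ Q : ℝ, k / √lam ≤ Q → √(d * k * T * (1 + k / lam)) ≤ 2 * Q →
      1 - δ ≤ μ.real {ω | P.regret θ best T ω ≤
        (C₀ + 1) * (1 + Real.log (d * T * N * k / δ)) ^ 2 *
          (max (d : ℝ) (Real.sqrt (d * lam)) * Q)} := by
    intro Q hQ1 hQ2
    refine hprob.trans (measureReal_mono fun ω (hω : P.regret θ best T ω ≤ _) =>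
      show P.regret θ best T ω ≤ _ from hω.trans
        ((CLS.bound_simplify hd hN hk hT hlam hR hS hδ hδ1 rfl rfl rfl rfl rfl hQ1 hQ2).trans ?_))
    have hQ0 : 0 ≤ Q := le_trans (by positivity) hQ1
    have hlx := Real.log_nonneg (CLS.one_le_ratio (d := d) (N := N) hd hN hk hT hδ hδ1)
    gcongr
    linarith
  constructor
  · intro hle
    refine hfinal _ ?_ ?_
    · refine Real.le_sqrt_of_sq_le ?_
      rw [div_pow, Real.sq_sqrt hl0.le]
      gcongr
      nlinarith [sq_nonneg (k : ℝ)]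
    · refine Real.sqrt_le_iff.2 ⟨by positivity, ?_⟩
      rw [mul_pow, Real.sq_sqrt (by positivity)]
      have h1 : 1 + k / lam ≤ 2 * (k / lam) := by
        have : 1 ≤ k / lam := by rw [le_div_iff₀ hl0]; linarith
        linarith
      calc (d : ℝ) * k * T * (1 + k / lam) ≤ d * k * T * (2 * (k / lam)) := by gcongr
        _ = 2 * (d * k ^ 2 * T / lam) := by ring
        _ ≤ 2 ^ 2 * (d * k ^ 2 * T / lam) := by gcongr; norm_num
  · intro hle
    refine hfinal _ ?_ ?_
    · refine Real.le_sqrt_of_sq_le ?_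
      rw [div_pow, Real.sq_sqrt hl0.le, div_le_iff₀ hl0]
      have h1 : (k : ℝ) ^ 2 ≤ k * lam := by nlinarith
      have h2 : (k : ℝ) * lam ≤ (d * T) * (k * lam) := le_mul_of_one_le_left (by positivity) hdT
      linarith
    · refine Real.sqrt_le_iff.2 ⟨by positivity, ?_⟩
      rw [mul_pow, Real.sq_sqrt (by positivity)]
      have h1 : 1 + k / lam ≤ 2 := by
        have : k / lam ≤ 1 := by rw [div_le_iff₀ hl0]; linarith
        linarith
      have h2 : (0 : ℝ) ≤ d * k * T := by positivity
      nlinarith
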